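/- Let $d\ge 1$ and $p\ge 1$, $\Upsilon$ be integers, let $\alpha>2d$ be real, and put $\Gamma=\Upsilon+1$. There is a constant $C>0$, depending only on $d,\alpha,p,\Upsilon$, such that the following holds whenever there is a $p$th-order $\Upsilon$-stage product formula for $\Gamma$ summands $$\mathscr S(t)=\prod_{\upsilon=1}^{\Upsilon}\prod_{\gamma=1}^{\Gamma}e^{-ita_{(\upsilon,\gamma)}H_{\pi_\upsilon(\gamma)}},\qquad |a_{(\upsilon,\gamma)}|\le 1,$$ where $\pi_\upsilon$ is the ordering $(2,4,6,\dots,1,3,5,\dots)$ for odd $\upsilon$ and $(1,3,5,\dots,2,4,6,\dots)$ for even $\upsilon$, and products are ordered with indices increasing from right to left. Here $p$th-order means that $\mathscr S(t)=e^{-it\sum_\gamma H_\gamma}+O(t^{p+1})$ as $t\to0$ for all Hermitian matrices $H_1,\dots,H_\Gamma$ (of any finite size) such that the $H_\gamma$ with even $\gamma$ commute with each other and those with odd $\gamma$ commute with each other. Let $\Lambda\subset\mathbb Z^d$ be a finite set with one qubit at each site, and let $H=\sum_{\vec i,\vec j\in\Lambda}H_{\vec i,\vec j}$ be a power-law Hamiltonian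 with exponent $\alpha$: each $H_{\vec i,\vec j}$ is Hermitian, acts nontrivially only on the sites $\vec i,\vec j$, and satisfies $\|H_{\vec i,\vec i}\|\le 1$ and $\|H_{\vec i,\vec j}\|\le\|\vec i-\vec j\|_2^{-\alpha}$ for $\vec i\ne\vec j$ (spectral norm). Let $A$ be an operator whose support is contained in a closed Euclidean ball with centre $\vec c\in\mathbb R^d$ and radius $x_0\ge0$. For positive integers $r$ and $\ell$, let the light-cone Hamiltonian $$H_{\mathrm{lc}}=\sum_{\substack{\vec i,\vec j\in\Lambda\\ \|\vec i-\vec c\|_2,\ \|\vec j-\vec c\|_2\,\le\, x_0+r\Gamma\ell}}H_{\vec i,\vec j}$$ be the sum of the terms of $H$ whose sites have distance at most $r\Gamma\ell$ to that ball. Then $H_{\mathrm{lc}}$ is supported on the ball with centre $\vec c$ and radius $x_0+r\Gamma\ell$, and for every $t\ge0$ $$\big\|e^{itH}Ae^{-itH}-e^{itH_{\mathrm{lc}}}Ae^{-itH_{\mathrm{lc}}}\big\|\le C\,\|A\|\;t\,(x_0+r\Gamma\ell)^{d-1}\left(\frac1{\ell^{\alpha-d-1}}+\ell\,\frac{t^p}{r^p}\right).$$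 In particular, the constant does not depend on the system size $|\Lambda|$. -/

import Mathlib

open scoped Matrix.Norms.L2Operator Kronecker Topology
open Asymptotics

namespace LocalObs

noncomputable section

/-! ### Qubits on a finite piece of the square lattice -/

/-- The position in Euclidean space of a point of the square lattice `ℤ^d`. -/
def pos {d : ℕ} (i : Fin d → ℤ) : EuclideanSpace ℝ (Fin d) :=
  WithLp.toLp 2 (fun k => (i k : ℝ))

/-- Operators on the Hilbert space `⨂_{i ∈ Λ} ℂ²` of one qubit per site of a finite set `Λ` of
lattice points, as matrices in the computational basis `Λ → Fin 2`. The norm on this type is the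
spectral norm (the scope `Matrix.Norms.L2Operator` is open). -/
abbrev Op {d : ℕ} (Λ : Finset (Fin d → ℤ)) : Type := Matrix (Λ → Fin 2) (Λ → Fin 2) ℂ

/-- `M` acts nontrivially only on the sites in `S`: it is `N ⊗ 1` with respect to the factorization
of the Hilbert space into the qubits in `S` and the qubits outside `S`. -/
def SupportedOn {d : ℕ} {Λ : Finset (Fin d → ℤ)} (M : Op Λ) (S : Finset Λ) : Prop :=
  ∃ N : Matrix ({i : Λ // i ∈ S} → Fin 2) ({i : Λ // i ∈ S} → Fin 2) ℂ,
    M = (N ⊗ₖ (1 : Matrix ({i : Λ // i ∉ S} → Fin 2) ({i : Λ // i ∉ S} → Fin 2) ℂ)).submatrix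
      (Equiv.piEquivPiSubtypeProd (fun i : Λ => i ∈ S) (fun _ => Fin 2))
      (Equiv.piEquivPiSubtypeProd (fun i : Λ => i ∈ S) (fun _ => Fin 2))

/-- The sites of `Λ` in the closed Euclidean ball of radius `R` around `c`. -/
def ballSites {d : ℕ} (Λ : Finset (Fin d → ℤ)) (c : EuclideanSpace ℝ (Fin d)) (R : ℝ) :
    Finset Λ :=
  Finset.univ.filter (fun i : Λ => dist (pos (i : Fin d → ℤ)) c ≤ R)

/-- The terms `h i j` (`i, j ∈ Λ`) of a power-law Hamiltonian with exponent `α`. -/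
structure IsPowerLaw {d : ℕ} {Λ : Finset (Fin d → ℤ)} (α : ℝ) (h : Λ → Λ → Op Λ) : Prop where
  isHermitian : ∀ i j, (h i j).IsHermitian
  supportedOn : ∀ i j, SupportedOn (h i j) {i, j}
  norm_le_one : ∀ i, ‖h i i‖ ≤ 1
  norm_le : ∀ i j, i ≠ j →
    ‖h i j‖ ≤ 1 / ‖pos (i : Fin d → ℤ) - pos (j : Fin d → ℤ)‖ ^ α

/-- The Hamiltonian `H = ∑_{i,j ∈ Λ} H_{i,j}`. -/
def hamiltonian {d : ℕ} {Λ : Finset (Fin d → ℤ)} (h : Λ → Λ → Op Λ) : Op Λ :=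
  ∑ i, ∑ j, h i j

/-- The light-cone Hamiltonian: the sum of the terms of `H` both of whose sites have distance at
most `y` to the ball of radius `x₀` around `c`, that is, lie in the ball of radius `x₀ + y`. -/
def lightConeHamiltonian {d : ℕ} {Λ : Finset (Fin d → ℤ)} (h : Λ → Λ → Op Λ)
    (c : EuclideanSpace ℝ (Fin d)) (x₀ y : ℝ) : Op Λ :=
  ∑ i ∈ ballSites Λ c (x₀ + y), ∑ j ∈ ballSites Λ c (x₀ + y), h i j

/-- The time-evolved observable `e^{itH} A e^{-itH}`. -/
def evolve {n : Type} [Fintype n] [DecidableEq n] (H A : Matrix n n ℂ) (t : ℝ) : Matrix n n ℂ :=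
  NormedSpace.exp ((Complex.I * (t : ℂ)) • H) * A * NormedSpace.exp ((-(Complex.I * (t : ℂ))) • H)

/-! ### Product formulas -/

/-- `∏_{k=1}^{m} f k`, with the indices increasing from right to left: `f m * ⋯ * f 2 * f 1`. -/
def rprod {M : Type} [Monoid M] (f : ℕ → M) : ℕ → M
  | 0 => 1
  | m + 1 => f (m + 1) * rprod f m

/-- The ordering `π_υ` of the summands `1, …, Γ` within stage `υ`: the position `k` carries the
`k`-th entry of `(2, 4, 6, …, 1, 3, 5, …)` if `υ` is odd, of `(1, 3, 5, …, 2, 4, 6, …)` if `υ` is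
even. -/
def stagePerm (Γ υ k : ℕ) : ℕ :=
  if Odd υ then
    if k ≤ Γ / 2 then 2 * k else 2 * (k - Γ / 2) - 1
  else
    if k ≤ (Γ + 1) / 2 then 2 * k - 1 else 2 * (k - (Γ + 1) / 2)

/-- The product formula
`∏_{υ=1}^{Υ} ∏_{γ=1}^{Γ} exp(-i t a_{(υ,γ)} H_{π_υ(γ)})` with `Υ` stages for the `Γ` summands
`H 1, …, H Γ`. -/
def productFormula {n : Type} [Fintype n] [DecidableEq n] (Υ Γ : ℕ) (a : ℕ → ℕ → ℝ)
    (H : ℕ → Matrix n n ℂ) (t : ℝ) : Matrix n n ℂ :=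
  rprod (fun υ => rprod (fun γ =>
    NormedSpace.exp ((-(Complex.I * (t : ℂ) * (a υ γ : ℂ))) • H (stagePerm Γ υ γ))) Γ) Υ

/-- `a` gives a `p`th-order `Υ`-stage product formula for `Γ` summands: the coefficients are at most
`1` in absolute value, and `𝒮(t) = e^{-itH} + O(t^{p+1})` as `t → 0` for all Hermitian summands
`H 1, …, H Γ` on a finite-dimensional space such that the even-numbered ones commute with each other
and the odd-numbered ones commute with each other. (The Suzuki formulas, with all coefficients of a
stage equal, have this property for the ordering `stagePerm`.) -/
structure IsProductFormula (p Υ Γ : ℕ) (a : ℕ → ℕ → ℝ) : Prop where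
  abs_le_one : ∀ υ ∈ Finset.Icc 1 Υ, ∀ γ ∈ Finset.Icc 1 Γ, |a υ γ| ≤ 1
  order : ∀ (n : Type) [Fintype n] [DecidableEq n] (H : ℕ → Matrix n n ℂ),
    (∀ γ ∈ Finset.Icc 1 Γ, (H γ).IsHermitian) →
    (∀ γ ∈ Finset.Icc 1 Γ, ∀ δ ∈ Finset.Icc 1 Γ, γ % 2 = δ % 2 → Commute (H γ) (H δ)) →
    (fun t : ℝ => productFormula Υ Γ a H t -
      NormedSpace.exp ((-(Complex.I * (t : ℂ))) • ∑ γ ∈ Finset.Icc 1 Γ, H γ))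
      =O[𝓝 0] (fun t : ℝ => t ^ (p + 1))

end

end LocalObs

/-! The product formula enters only through the inequality `p + 1 ≤ Γ`. To see it, test the order
condition on a hopping chain with sites `0, …, Υ + 1`, whose bonds are the `Γ = Υ + 1` summands.
With the alternating even/odd ordering, a stage moves an excitation at most one site further, so `Υ`
stages started at site `0` never reach the last site. The exact evolution reaches it with amplitude
of order `t ^ (Υ + 1)`. Hence `p ≤ Υ` (`IsProductFormula.order_le`).

The rest is a light-cone estimate for power-law interactions. Cut the time into `r` steps of length
`τ = t / r` and let the ball grow by `Γ ℓ ≥ (p + 1) ℓ` in each step. Within a step, Duhamel's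
formula bounds the error of restricting `H` to the new ball, of radius at most `R = x₀ + r Γ ℓ`, by
`τ` times the commutators of the dropped terms with the observable evolved inside that ball. Terms
entirely outside commute with it. Terms crossing the boundary with length more than `ℓ` have total
strength of order `R ^ (d - 1) * ℓ ^ (d + 1 - α)`. Shorter crossing terms have total strength of
order `R ^ (d - 1) * ℓ` and lie at least `p` hops of length `ℓ` away from the old ball, so that the
Lieb–Robinson bound `norm_evolve_commutator_le` gives an extra factor `τ ^ p + ℓ ^ (d - α)`. Summing
over the steps gives the claim (`exists_evolve_sub_restrictBall_le`, `norm_evolve_sub_step_le`).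

The same chain of approximants serves for `H` and for the light-cone Hamiltonian, because both have
the same restrictions to the smaller balls. If `τ > 1`, the bound is trivial. -/

namespace LocalObs

/-! ### A product formula of order `p` has at least `p` stages -/

/-- The hopping matrix between the neighbouring sites `γ - 1` and `γ` of the chain `0, …, N`. -/
def hop (N γ : ℕ) : Matrix (Fin (N + 1)) (Fin (N + 1)) ℂ :=
  Matrix.of fun i j =>
    if ((i : ℕ) + 1 = γ ∧ (j : ℕ) = γ) ∨ ((j : ℕ) + 1 = γ ∧ (i : ℕ) = γ) then 1 else 0

/-- The projection onto the first `k` sites of the chain `0, …, N`. -/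
def firstSites (N k : ℕ) : Matrix (Fin (N + 1)) (Fin (N + 1)) ℂ :=
  Matrix.diagonal fun i => if (i : ℕ) < k then 1 else 0

theorem hop_isHermitian (N γ : ℕ) : (hop N γ).IsHermitian := by
  ext i j
  simp only [Matrix.conjTranspose_apply, hop, Matrix.of_apply]
  rw [apply_ite star]
  simp only [star_one, star_zero]
  congr 1
  exact propext or_comm

/-- Distinct bonds of equal parity share no site, so their products vanish in both orders. -/
theorem hop_commute (N : ℕ) {γ δ : ℕ} (h : γ % 2 = δ % 2) : Commute (hop N γ) (hop N δ) := by
  by_cases hγδ : γ = δ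
  · rw [hγδ]
  have key : ∀ γ δ : ℕ, γ % 2 = δ % 2 → γ ≠ δ → hop N γ * hop N δ = 0 := by
    intro γ δ h h'
    ext i j
    rw [Matrix.mul_apply]
    refine Finset.sum_eq_zero fun k _ => ?_
    simp only [hop, Matrix.of_apply]
    split_ifs with h1 h2
    · omega
    all_goals simp
  rw [Commute, SemiconjBy, key γ δ h hγδ, key δ γ h.symm (Ne.symm hγδ)]

/-- Bond `k` is the only one that joins the sites below `k` to the others. -/
theorem hop_commute_firstSites (N : ℕ) {γ k : ℕ} (h : γ ≠ k) :
    Commute (firstSites N k) (hop N γ) := by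
  ext i j
  simp only [firstSites, hop, Matrix.diagonal_mul, Matrix.mul_diagonal, Matrix.of_apply]
  split_ifs <;> first | omega | simp

theorem firstSites_mul (N : ℕ) {k l : ℕ} (h : k ≤ l) :
    firstSites N l * firstSites N k = firstSites N k := by
  simp only [firstSites, Matrix.diagonal_mul_diagonal]
  congr 1
  ext i
  split_ifs <;> first | omega | simp

theorem firstSites_mul_succ {N k : ℕ} {Q : Matrix (Fin (N + 1)) (Fin (N + 1)) ℂ}
    (h : firstSites N k * Q = Q) : firstSites N (k + 1) * Q = Q := by
  rw [← h, ← mul_assoc, firstSites_mul N (Nat.le_succ k)]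

theorem firstSites_mul_of_commute {N k : ℕ} {M Q : Matrix (Fin (N + 1)) (Fin (N + 1)) ℂ}
    (hM : Commute (firstSites N k) M) (h : firstSites N k * Q = Q) :
    firstSites N k * (M * Q) = M * Q := by
  rw [← mul_assoc, hM.eq, mul_assoc, h]

/-- One stage of a product formula for the hopping chain transports an excitation by at most one
site. -/
theorem firstSites_stage {N υ : ℕ} (Γ : ℕ) (hυ : 1 ≤ υ) (z : ℕ → ℂ)
    {Q : Matrix (Fin (N + 1)) (Fin (N + 1)) ℂ} (h : firstSites N υ * Q = Q) :
    firstSites N (υ + 1) *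
      (rprod (fun γ => NormedSpace.exp (z γ • hop N (stagePerm Γ υ γ))) Γ * Q) =
      rprod (fun γ => NormedSpace.exp (z γ • hop N (stagePerm Γ υ γ))) Γ * Q := by
  set f := fun γ => NormedSpace.exp (z γ • hop N (stagePerm Γ υ γ)) with hf
  -- The first `m` factors to act carry summands of parity opposite to `υ`, hence never bond `υ`,
  -- and do not enlarge the first `υ` sites. The later ones have the parity of `υ`, hence are never
  -- bond `υ + 1`, and stay within the first `υ + 1` sites.
  set m := if Odd υ then Γ / 2 else (Γ + 1) / 2 with hm
  have comm : ∀ γ k, stagePerm Γ υ γ ≠ k → Commute (firstSites N k) (f γ) := fun γ k hne =>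
    ((hop_commute_firstSites N hne).smul_right _).exp_right
  have key : ∀ j, (j ≤ m → firstSites N υ * (rprod f j * Q) = rprod f j * Q) ∧
      firstSites N (υ + 1) * (rprod f j * Q) = rprod f j * Q := by
    intro j
    induction j with
    | zero =>
      simp only [rprod, one_mul]
      exact ⟨fun _ => h, firstSites_mul_succ h⟩
    | succ j ih =>
      simp only [rprod, mul_assoc]
      by_cases hj : j + 1 ≤ m
      · have h1 : firstSites N υ * (f (j + 1) * (rprod f j * Q)) =
            f (j + 1) * (rprod f j * Q) := by
          refine firstSites_mul_of_commute (comm _ _ ?_) (ih.1 (by omega))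
          unfold stagePerm
          rcases Nat.even_or_odd υ with he | ho
          · rw [if_neg (Nat.not_odd_iff_even.2 he)] at hm ⊢
            obtain ⟨a, ha⟩ := he
            rw [if_pos (by omega)]
            omega
          · rw [if_pos ho] at hm ⊢
            obtain ⟨a, ha⟩ := ho
            rw [if_pos (by omega)]
            omega
        exact ⟨fun _ => h1, firstSites_mul_succ h1⟩
      · refine ⟨fun h' => absurd h' hj, firstSites_mul_of_commute (comm _ _ ?_) ih.2⟩
        unfold stagePerm
        rcases Nat.even_or_odd υ with he | ho
        · rw [if_neg (Nat.not_odd_iff_even.2 he)] at hm ⊢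
          obtain ⟨a, ha⟩ := he
          rw [if_neg (by omega)]
          omega
        · rw [if_pos ho] at hm ⊢
          obtain ⟨a, ha⟩ := ho
          rw [if_neg (by omega)]
          omega
  exact (key Γ).2

theorem firstSites_productFormula (N Υ Γ : ℕ) (a : ℕ → ℕ → ℝ) (t : ℝ) :
    firstSites N (Υ + 1) * (productFormula Υ Γ a (hop N) t * firstSites N 1) =
      productFormula Υ Γ a (hop N) t * firstSites N 1 := by
  unfold productFormula
  induction Υ with
  | zero => simp [rprod, firstSites_mul]
  | succ υ ih =>
    rw [rprod, mul_assoc]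
    exact firstSites_stage Γ (Nat.succ_le_succ (Nat.zero_le υ)) _ ih

theorem productFormula_hop_apply_last (Υ : ℕ) (a : ℕ → ℕ → ℝ) (t : ℝ) :
    productFormula Υ (Υ + 1) a (hop (Υ + 1)) t (Fin.last (Υ + 1)) 0 = 0 := by
  have h := congrFun (congrFun (firstSites_productFormula (Υ + 1) Υ (Υ + 1) a t)
    (Fin.last (Υ + 1))) 0
  simpa [firstSites, Matrix.diagonal_mul, Matrix.mul_diagonal] using h.symm

/-- The Hamiltonian of the hopping chain `0, …, N`. -/
def hopSum (N : ℕ) : Matrix (Fin (N + 1)) (Fin (N + 1)) ℂ := ∑ γ ∈ Finset.Icc 1 N, hop N γ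

theorem hopSum_apply_eq_zero {N : ℕ} {i j : Fin (N + 1)} (h : (j : ℕ) + 1 < i) :
    hopSum N i j = 0 := by
  rw [hopSum, Matrix.sum_apply]
  refine Finset.sum_eq_zero fun γ _ => ?_
  simp only [hop, Matrix.of_apply]
  rw [if_neg (by omega)]

theorem hopSum_apply_succ {N : ℕ} {i j : Fin (N + 1)} (h : (i : ℕ) = j + 1) :
    hopSum N i j = 1 := by
  have hi := i.isLt
  rw [hopSum, Matrix.sum_apply, Finset.sum_eq_single (i : ℕ)]
  · simp only [hop, Matrix.of_apply]
    exact if_pos (by simp [h])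
  · intro γ _ hγ
    simp only [hop, Matrix.of_apply]
    exact if_neg (by omega)
  · intro h'
    simp only [Finset.mem_Icc] at h'
    omega

/-- The entries count walks along the chain: `k` steps from `0` cannot go beyond `k`, and only one
walk of `k` steps ends there. -/
theorem hopSum_pow_apply (N k : ℕ) :
    (∀ i : Fin (N + 1), k < i → (hopSum N ^ k) i 0 = 0) ∧
      ∀ i : Fin (N + 1), (i : ℕ) = k → (hopSum N ^ k) i 0 = 1 := by
  induction k with
  | zero =>
    refine ⟨fun i hi => ?_, fun i hi => ?_⟩
    · rw [pow_zero, Matrix.one_apply_ne (by rintro rfl; simp at hi)]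
    · rw [pow_zero, show i = 0 from Fin.ext hi, Matrix.one_apply_eq]
  | succ k ih =>
    refine ⟨fun i hi => ?_, fun i hi => ?_⟩
    · rw [pow_succ', Matrix.mul_apply]
      refine Finset.sum_eq_zero fun j _ => ?_
      rcases lt_or_ge k j with h | h
      · rw [ih.1 j h, mul_zero]
      · rw [hopSum_apply_eq_zero (by omega), zero_mul]
    · have hk : k < N + 1 := by have := i.isLt; omega
      rw [pow_succ', Matrix.mul_apply, Finset.sum_eq_single (⟨k, hk⟩ : Fin (N + 1))]
      · rw [ih.2 ⟨k, hk⟩ rfl, hopSum_apply_succ (by simpa using hi), mul_one]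
      · intro j _ hj
        rcases lt_or_ge k j with h | h
        · rw [ih.1 j h, mul_zero]
        · have : (j : ℕ) ≠ k := fun h' => hj (Fin.ext h')
          rw [hopSum_apply_eq_zero (by omega), zero_mul]
      · simp

/-- In the exponential series, the powers below `N` do not connect the two ends of the chain, so the
term of order `N` leads. -/
theorem exp_hopSum_apply_isBigO (N : ℕ) :
    (fun t : ℝ => NormedSpace.exp ((-(Complex.I * (t : ℂ))) • hopSum N) (Fin.last N) 0 -
      (N.factorial : ℂ)⁻¹ * (-(Complex.I * (t : ℂ))) ^ N) =O[𝓝 0] fun t : ℝ => t ^ (N + 1) := by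
  have h1 := (NormedSpace.exp_hasFPowerSeriesAt_zero (𝕂 := ℂ)
    (𝔸 := Matrix (Fin (N + 1)) (Fin (N + 1)) ℂ)).isBigO_sub_partialSum_pow (N + 1)
  have hc : Filter.Tendsto (fun t : ℝ => (-(Complex.I * (t : ℂ))) • hopSum N) (𝓝 0) (𝓝 0) := by
    have : Continuous (fun t : ℝ => (-(Complex.I * (t : ℂ))) • hopSum N) := by fun_prop
    simpa using this.tendsto 0
  have h2 := h1.comp_tendsto hc
  let e : Matrix (Fin (N + 1)) (Fin (N + 1)) ℂ →L[ℂ] ℂ :=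
    LinearMap.toContinuousLinearMap (Matrix.entryLinearMap ℂ ℂ (Fin.last N) 0)
  have h3 := (e.isBigO_comp _ _).trans h2
  refine (h3.congr_left fun t => ?_).trans ?_
  · simp only [Function.comp_apply, zero_add, map_sub]
    congr 1
    generalize -(Complex.I * (t : ℂ)) = z
    rw [FormalMultilinearSeries.partialSum, map_sum, Finset.sum_range_succ, Finset.sum_eq_zero,
      zero_add, NormedSpace.expSeries_apply_eq]
    · simp [e, smul_pow, (hopSum_pow_apply N N).2]
    · intro k hk
      rw [NormedSpace.expSeries_apply_eq]
      simp [e, smul_pow, (hopSum_pow_apply N k).1 (Fin.last N) (by simpa using hk)]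
  · refine IsBigO.of_bound (‖hopSum N‖ ^ (N + 1)) (Filter.Eventually.of_forall fun t => ?_)
    simp [norm_smul, mul_pow, mul_comm]

/-- For `p > Υ` the corner entry of the exact evolution would be `O(t ^ (Υ + 2))`, since that of the
product formula vanishes. Its leading term is a nonzero multiple of `t ^ (Υ + 1)`. -/
theorem IsProductFormula.order_le {p Υ : ℕ} {a : ℕ → ℕ → ℝ}
    (ha : IsProductFormula p Υ (Υ + 1) a) : p ≤ Υ := by
  by_contra hlt
  have h1 := ha.order (Fin (Υ + 1 + 1)) (hop (Υ + 1)) (fun γ _ => hop_isHermitian _ γ)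
    (fun γ _ δ _ h => hop_commute _ h)
  let e : Matrix (Fin (Υ + 1 + 1)) (Fin (Υ + 1 + 1)) ℂ →L[ℂ] ℂ :=
    LinearMap.toContinuousLinearMap (Matrix.entryLinearMap ℂ ℂ (Fin.last (Υ + 1)) 0)
  have h2 := (e.isBigO_comp _ _).trans h1
  have h3 : (fun t : ℝ => NormedSpace.exp ((-(Complex.I * (t : ℂ))) • hopSum (Υ + 1))
      (Fin.last (Υ + 1)) 0) =O[𝓝 0] fun t : ℝ => t ^ (Υ + 1 + 1) := by
    have h4 : (fun t : ℝ => t ^ (p + 1)) =O[𝓝 0] fun t : ℝ => t ^ (Υ + 1 + 1) := by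
      refine IsBigO.of_bound 1 ?_
      filter_upwards [Metric.closedBall_mem_nhds (0 : ℝ) one_pos] with t ht
      rw [Metric.mem_closedBall, dist_zero_right] at ht
      rw [one_mul, norm_pow, norm_pow]
      exact pow_le_pow_of_le_one (norm_nonneg t) ht (by omega)
    refine ((h2.trans h4).neg_left).congr_left fun t => ?_
    simp only [map_sub]
    simp [e, productFormula_hop_apply_last, hopSum]
  have h5 := h3.sub (exp_hopSum_apply_isBigO (Υ + 1))
  have h6 : (fun t : ℝ => t ^ (Υ + 1)) =O[𝓝 0] fun t : ℝ => t ^ (Υ + 1 + 1) := by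
    refine IsBigO.trans ?_ h5
    refine IsBigO.of_bound ((Υ + 1).factorial : ℝ) (Filter.Eventually.of_forall fun t => ?_)
    have : ((Υ + 1).factorial : ℝ) ≠ 0 := by positivity
    rw [sub_sub_cancel, norm_mul, norm_inv, norm_pow, norm_pow, norm_neg, norm_mul, Complex.norm_I,
      one_mul, Complex.norm_natCast, Complex.norm_real, mul_inv_cancel_left₀ this]
  obtain ⟨c, hc⟩ := h6.bound
  have h7 : ∀ᶠ t : ℝ in 𝓝 0, t ≠ 0 → 1 ≤ c * ‖t‖ := by
    filter_upwards [hc] with t ht h0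
    have : 0 < ‖t ^ (Υ + 1)‖ := norm_pos_iff.2 (pow_ne_zero _ h0)
    rw [pow_succ t (Υ + 1), norm_mul] at ht
    nlinarith
  have h8 : ∀ᶠ t : ℝ in 𝓝[≠] 0, 1 ≤ c * ‖t‖ := by
    rw [eventually_nhdsWithin_iff]
    exact h7
  have h9 : Filter.Tendsto (fun t : ℝ => c * ‖t‖) (𝓝[≠] 0) (𝓝 0) := by
    have : Continuous fun t : ℝ => c * ‖t‖ := by fun_prop
    simpa using (this.tendsto 0).mono_left nhdsWithin_le_nhds
  have := ge_of_tendsto h9 h8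
  norm_num at this

/-! ### Lattice sums -/

theorem pos_sub {d : ℕ} (i j : Fin d → ℤ) : pos (i - j) = pos i - pos j := by
  ext k
  simp [pos]

theorem one_le_norm_pos {d : ℕ} {v : Fin d → ℤ} (hv : v ≠ 0) : 1 ≤ ‖pos v‖ := by
  obtain ⟨k, hk⟩ := Function.ne_iff.1 hv
  calc (1 : ℝ) ≤ |((v k : ℤ) : ℝ)| := by exact_mod_cast Int.one_le_abs hk
    _ = ‖pos v k‖ := by simp [pos]
    _ ≤ ‖pos v‖ := PiLp.norm_apply_le _ _

theorem one_le_dist_pos {d : ℕ} {i j : Fin d → ℤ} (h : i ≠ j) : 1 ≤ dist (pos i) (pos j) := by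
  rw [dist_eq_norm, ← pos_sub]
  exact one_le_norm_pos (sub_ne_zero.2 h)

theorem pow_sub_pow_le {a b : ℝ} (ha : 0 ≤ a) (hab : a ≤ b) (d : ℕ) :
    b ^ d - a ^ d ≤ d * b ^ (d - 1) * (b - a) := by
  rw [← Commute.geom_sum₂_mul (Commute.all b a) d]
  refine mul_le_mul_of_nonneg_right ?_ (sub_nonneg.2 hab)
  calc ∑ i ∈ Finset.range d, b ^ i * a ^ (d - 1 - i)
      ≤ ∑ i ∈ Finset.range d, b ^ (d - 1) := by
        refine Finset.sum_le_sum fun i hi => ?_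
        have hi' : i + (d - 1 - i) = d - 1 := by have := Finset.mem_range.1 hi; omega
        calc b ^ i * a ^ (d - 1 - i) ≤ b ^ i * b ^ (d - 1 - i) := by
              have := ha.trans hab
              gcongr
          _ = b ^ (d - 1) := by rw [← pow_add, hi']
    _ = d * b ^ (d - 1) := by simp

/-- The number of lattice points in a spherical shell, by comparing the volume of the disjoint balls
of radius `1 / 2` around them with that of a slightly thicker shell. -/
theorem card_mul_le_of_shell {d : ℕ} (hd : 1 ≤ d) (T : Finset (Fin d → ℤ))
    (c : EuclideanSpace ℝ (Fin d)) {a b : ℝ} (ha : 0 ≤ a) (hb : 0 ≤ b)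
    (h1 : ∀ i ∈ T, a ≤ dist (pos i) c - 1 / 2 ∨ a = 0) (h2 : ∀ i ∈ T, dist (pos i) c + 1 / 2 ≤ b) :
    (T.card : ℝ) * (1 / 2) ^ d + a ^ d ≤ b ^ d ∨ (T = ∅) := by
  -- Without points nothing forces `a ≤ b`, so the empty set is a separate alternative.
  by_cases hT : T = ∅
  · exact Or.inr hT
  left
  have : Nonempty (Fin d) := ⟨⟨0, hd⟩⟩
  let μ : MeasureTheory.Measure (EuclideanSpace ℝ (Fin d)) := MeasureTheory.volume
  set v := μ (Metric.ball 0 1) with hv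
  have hv0 : v ≠ 0 := (Metric.measure_ball_pos μ _ one_pos).ne'
  have hvt : v ≠ ⊤ := MeasureTheory.measure_ball_lt_top.ne
  have hball : ∀ (x : EuclideanSpace ℝ (Fin d)) {r : ℝ}, 0 ≤ r →
      μ (Metric.ball x r) = ENNReal.ofReal (r ^ d) * v := by
    intro x r hr
    rw [MeasureTheory.Measure.addHaar_ball μ x hr, finrank_euclideanSpace_fin]
  have hdisj : Set.PairwiseDisjoint (T : Set (Fin d → ℤ))
      (fun i => Metric.ball (pos i) (1 / 2)) := by
    intro i _ j _ hij
    exact Metric.ball_disjoint_ball (by have := one_le_dist_pos hij; linarith)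
  have hU : μ (⋃ i ∈ T, Metric.ball (pos i) (1 / 2)) =
      ENNReal.ofReal (T.card * (1 / 2) ^ d) * v := by
    rw [MeasureTheory.measure_biUnion_finset hdisj fun i _ => measurableSet_ball,
      Finset.sum_congr rfl fun i _ => hball (pos i) (by norm_num : (0 : ℝ) ≤ 1 / 2)]
    rw [Finset.sum_const, nsmul_eq_mul, ← mul_assoc, ENNReal.ofReal_mul (by positivity)]
    simp
  have hdisj2 : Disjoint (⋃ i ∈ T, Metric.ball (pos i) (1 / 2)) (Metric.ball c a) := by
    simp only [Set.disjoint_iUnion_left]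
    intro i hi
    rcases h1 i hi with h | h
    · exact Metric.ball_disjoint_ball (by linarith)
    · rw [h]; simp
  have hsub : (⋃ i ∈ T, Metric.ball (pos i) (1 / 2)) ∪ Metric.ball c a ⊆ Metric.ball c b := by
    obtain ⟨i, hi⟩ := Finset.nonempty_iff_ne_empty.2 hT
    refine Set.union_subset ?_ (Metric.ball_subset_ball ?_)
    · simp only [Set.iUnion_subset_iff]
      intro i hi
      exact Metric.ball_subset_ball' (by linarith [h2 i hi])
    · rcases h1 i hi with h | h
      · linarith [h2 i hi]
      · rw [h]; exact hb
  have := MeasureTheory.measure_mono (μ := μ) hsub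
  rw [MeasureTheory.measure_union hdisj2 measurableSet_ball, hU, hball c ha, hball c hb, ← add_mul,
    ENNReal.mul_le_mul_iff_left hv0 hvt, ← ENNReal.ofReal_add (by positivity) (by positivity),
    ENNReal.ofReal_le_ofReal_iff (by positivity)] at this
  exact this

/-- The number of lattice points in a spherical shell of outer radius `R` and width `w`. -/
theorem card_shell_le {d : ℕ} (hd : 1 ≤ d) (T : Finset (Fin d → ℤ))
    (c : EuclideanSpace ℝ (Fin d)) {R w : ℝ} (hR : 1 / 2 ≤ R) (hw : 1 / 2 ≤ w)
    (h1 : ∀ i ∈ T, R - w ≤ dist (pos i) c) (h2 : ∀ i ∈ T, dist (pos i) c ≤ R) :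
    (T.card : ℝ) ≤ 3 * 4 ^ d * d * R ^ (d - 1) * w := by
  have hRw : 0 ≤ R ^ (d - 1) * w := by positivity
  -- The shell is thickened by `1 / 2` on both sides to contain the balls around its points. The
  -- cut-off at `0` covers the case where no inner ball remains.
  have h0 : ∀ i ∈ T, max (R - w - 1 / 2) 0 ≤ dist (pos i) c - 1 / 2 ∨ max (R - w - 1 / 2) 0 = 0 := by
    intro i hi
    rcases le_total (R - w - 1 / 2) 0 with h | h
    · exact Or.inr (max_eq_right h)
    · left
      rw [max_eq_left h]
      linarith [h1 i hi]
  rcases card_mul_le_of_shell hd T c (a := max (R - w - 1 / 2) 0) (b := R + 1 / 2) (le_max_right _ _)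
    (by linarith) h0 (fun i hi => by linarith [h2 i hi]) with h | h
  · have h3 := pow_sub_pow_le (a := max (R - w - 1 / 2) 0) (b := R + 1 / 2) (le_max_right _ _)
      (max_le (by linarith) (by linarith)) d
    have h4 : R + 1 / 2 - max (R - w - 1 / 2) 0 ≤ 3 * w := by
      have := le_max_left (R - w - 1 / 2) 0
      linarith
    have h5 : (T.card : ℝ) * (1 / 2) ^ d ≤ d * (2 * R) ^ (d - 1) * (3 * w) := by
      calc (T.card : ℝ) * (1 / 2) ^ d
          ≤ d * (R + 1 / 2) ^ (d - 1) * (R + 1 / 2 - max (R - w - 1 / 2) 0) := by linarith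
        _ ≤ d * (2 * R) ^ (d - 1) * (3 * w) := by
            gcongr
            · exact sub_nonneg.2 (max_le (by linarith) (by linarith))
            · linarith
    calc (T.card : ℝ) = (T.card * (1 / 2) ^ d) * 2 ^ d := by
          rw [mul_assoc, ← mul_pow]; norm_num
      _ ≤ (d * (2 * R) ^ (d - 1) * (3 * w)) * 2 ^ d := by gcongr
      _ = 3 * (2 ^ d * 2 ^ (d - 1)) * d * R ^ (d - 1) * w := by rw [mul_pow]; ring
      _ ≤ 3 * (2 ^ d * 2 ^ d) * d * R ^ (d - 1) * w := by
          gcongr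
          · norm_num
          · omega
      _ = 3 * 4 ^ d * d * R ^ (d - 1) * w := by rw [← mul_pow]; norm_num
  · rw [h, Finset.card_empty, Nat.cast_zero]
    positivity

theorem card_ball_le {d : ℕ} (hd : 1 ≤ d) (T : Finset (Fin d → ℤ))
    (c : EuclideanSpace ℝ (Fin d)) {R : ℝ} (hR : 1 / 2 ≤ R)
    (h : ∀ i ∈ T, dist (pos i) c ≤ R) : (T.card : ℝ) ≤ 3 * 4 ^ d * d * R ^ d := by
  have := card_shell_le hd T c hR hR (fun i _ => by simp) h
  rwa [mul_assoc, ← pow_succ, Nat.sub_add_cancel hd] at this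

/-- Bound for the tail of `∑ ‖v‖ ^ (-s)`. -/
theorem exists_sum_rpow_le {d : ℕ} (hd : 1 ≤ d) {s : ℝ} (hs : (d : ℝ) < s) :
    ∃ K : ℝ, 0 < K ∧ ∀ (T : Finset (Fin d → ℤ)) (ℓ : ℝ), 1 / 2 ≤ ℓ →
      (∀ v ∈ T, ℓ < ‖pos v‖) → ∑ v ∈ T, 1 / ‖pos v‖ ^ s ≤ K * ℓ ^ ((d : ℝ) - s) := by
  have hq : (2 : ℝ) ^ ((d : ℝ) - s) < 1 :=
    Real.rpow_lt_one_of_one_lt_of_neg one_lt_two (by linarith)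
  set q : ℝ := (2 : ℝ) ^ ((d : ℝ) - s) with hqdef
  set B : ℝ := 3 * 4 ^ d * d * 2 ^ d with hB
  have hd0 : (0 : ℝ) < d := by exact_mod_cast hd
  have hBpos : 0 < B := by positivity
  refine ⟨B / (1 - q), div_pos hBpos (by linarith), ?_⟩
  -- The constant sums the geometric series of dyadic shells: a shell costs `B`, and doubling `ℓ`
  -- multiplies the remaining tail by `q`.
  have hK : B + B / (1 - q) * q = B / (1 - q) := by
    have : 1 - q ≠ 0 := by linarith
    field_simp
    ring
  have hK0 : 0 ≤ B / (1 - q) := (div_pos hBpos (by linarith)).le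
  set K := B / (1 - q) with hKdef
  -- Induction on the number `M` of dyadic shells that contain `T`.
  have key : ∀ (M : ℕ) (T : Finset (Fin d → ℤ)) (ℓ : ℝ), 1 / 2 ≤ ℓ →
      (∀ v ∈ T, ℓ < ‖pos v‖) → (∀ v ∈ T, ‖pos v‖ ≤ 2 ^ M * ℓ) →
      ∑ v ∈ T, 1 / ‖pos v‖ ^ s ≤ K * ℓ ^ ((d : ℝ) - s) := by
    intro M
    induction M with
    | zero =>
      intro T ℓ hℓ h1 h2
      rw [Finset.sum_eq_zero]
      · have : 0 < ℓ := by linarith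
        positivity
      · intro v hv
        have := h1 v hv
        have := h2 v hv
        linarith
    | succ M ih =>
      intro T ℓ hℓ h1 h2
      have hℓ0 : 0 < ℓ := by linarith
      rw [← Finset.sum_filter_add_sum_filter_not T (fun v => ‖pos v‖ ≤ 2 * ℓ)]
      have hnear : ∑ v ∈ T with ‖pos v‖ ≤ 2 * ℓ, 1 / ‖pos v‖ ^ s ≤ B * ℓ ^ ((d : ℝ) - s) := by
        calc ∑ v ∈ T with ‖pos v‖ ≤ 2 * ℓ, 1 / ‖pos v‖ ^ s
            ≤ ∑ v ∈ T with ‖pos v‖ ≤ 2 * ℓ, 1 / ℓ ^ s := by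
              refine Finset.sum_le_sum fun v hv => ?_
              have := h1 v (Finset.mem_filter.1 hv).1
              have hs0 : 0 ≤ s := by linarith
              gcongr
          _ = ((T.filter fun v => ‖pos v‖ ≤ 2 * ℓ).card : ℝ) * (1 / ℓ ^ s) := by
              rw [Finset.sum_const, nsmul_eq_mul]
          _ ≤ (3 * 4 ^ d * d * (2 * ℓ) ^ d) * (1 / ℓ ^ s) := by
              refine mul_le_mul_of_nonneg_right ?_ (by positivity)
              refine card_ball_le hd _ 0 (by linarith) fun v hv => ?_
              rw [dist_zero_right]
              exact (Finset.mem_filter.1 hv).2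
          _ = B * ℓ ^ ((d : ℝ) - s) := by
              rw [Real.rpow_sub hℓ0, Real.rpow_natCast, mul_pow, hB]
              ring
      have hfar : ∑ v ∈ T with ¬ ‖pos v‖ ≤ 2 * ℓ, 1 / ‖pos v‖ ^ s ≤
          K * (2 * ℓ) ^ ((d : ℝ) - s) := by
        refine ih _ (2 * ℓ) (by linarith) (fun v hv => ?_) (fun v hv => ?_)
        · exact not_le.1 (Finset.mem_filter.1 hv).2
        · have := h2 v (Finset.mem_filter.1 hv).1
          rw [pow_succ] at this
          linarith
      rw [Real.mul_rpow (by norm_num) hℓ0.le] at hfar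
      calc _ ≤ B * ℓ ^ ((d : ℝ) - s) + K * (q * ℓ ^ ((d : ℝ) - s)) := add_le_add hnear hfar
        _ = (B + K * q) * ℓ ^ ((d : ℝ) - s) := by ring
        _ = K * ℓ ^ ((d : ℝ) - s) := by rw [hK]
  intro T ℓ hℓ h1
  obtain ⟨M, hM⟩ : ∃ M : ℕ, ∀ v ∈ T, ‖pos v‖ ≤ 2 ^ M * ℓ := by
    obtain ⟨M, hM⟩ := pow_unbounded_of_one_lt (2 * ∑ v ∈ T, ‖pos v‖) (one_lt_two (α := ℝ))
    refine ⟨M, fun v hv => ?_⟩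
    have := Finset.single_le_sum (f := fun v => ‖pos v‖) (fun _ _ => norm_nonneg _) hv
    have h0 : (0 : ℝ) ≤ 2 ^ M := by positivity
    nlinarith
  exact key M T ℓ hℓ h1 hM

/-- The total strength of the long-range couplings across the boundary of a ball. -/
theorem exists_sum_crossing_le {d : ℕ} (hd : 1 ≤ d) {α : ℝ} (hα : (d : ℝ) + 1 < α) :
    ∃ K : ℝ, 0 < K ∧ ∀ (Λ : Finset (Fin d → ℤ)) (c : EuclideanSpace ℝ (Fin d)) (R ℓ : ℝ),
      1 ≤ R → 1 ≤ ℓ →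
      ∑ i ∈ Λ, ∑ j ∈ Λ, (if dist (pos i) c ≤ R ∧ R < dist (pos j) c ∧ ℓ < ‖pos i - pos j‖
        then 1 / ‖pos i - pos j‖ ^ α else 0) ≤ K * R ^ (d - 1) * ℓ ^ ((d : ℝ) + 1 - α) := by
  obtain ⟨K, hK0, hK⟩ := exists_sum_rpow_le hd (s := α - 1) (by linarith)
  have hd0 : (0 : ℝ) < d := by exact_mod_cast hd
  refine ⟨3 * 4 ^ d * d * K, by positivity, fun Λ c R ℓ hR hℓ => ?_⟩
  set V := (Λ ×ˢ Λ).image (fun x => x.1 - x.2) with hV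
  -- Pairs are grouped by their difference `v`. The inner site then determines the pair and lies in
  -- a shell of width `‖pos v‖` inside the sphere, which costs one power of the distance and leaves
  -- a tail with exponent `α - 1 > d`.
  have h1 : ∀ v : Fin d → ℤ, ∑ x ∈ (Λ ×ˢ Λ) with x.1 - x.2 = v,
      (if dist (pos x.1) c ≤ R ∧ R < dist (pos x.2) c ∧ ℓ < ‖pos x.1 - pos x.2‖
        then 1 / ‖pos x.1 - pos x.2‖ ^ α else 0) ≤
      if ℓ < ‖pos v‖ then 3 * 4 ^ d * d * R ^ (d - 1) * (1 / ‖pos v‖ ^ (α - 1)) else 0 := by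
    intro v
    split_ifs with hv
    · have hv0 : 0 < ‖pos v‖ := by linarith
      calc _ ≤ ∑ x ∈ (Λ ×ˢ Λ) with x.1 - x.2 = v,
            (if dist (pos x.1) c ≤ R ∧ R < dist (pos x.2) c then 1 / ‖pos v‖ ^ α else 0) := by
            refine Finset.sum_le_sum fun x hx => ?_
            rw [← pos_sub, (Finset.mem_filter.1 hx).2]
            split_ifs <;> tauto
        _ = ((((Λ ×ˢ Λ).filter fun x => x.1 - x.2 = v).filter fun x =>
              dist (pos x.1) c ≤ R ∧ R < dist (pos x.2) c).card : ℝ) * (1 / ‖pos v‖ ^ α) := by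
            rw [← Finset.sum_filter, Finset.sum_const, nsmul_eq_mul]
        _ ≤ (3 * 4 ^ d * d * R ^ (d - 1) * ‖pos v‖) * (1 / ‖pos v‖ ^ α) := by
            refine mul_le_mul_of_nonneg_right ?_ (by positivity)
            rw [← Finset.card_image_of_injOn (f := Prod.fst)]
            · refine card_shell_le hd _ c (by linarith) (by linarith) ?_ ?_
              · intro i hi
                obtain ⟨x, hx, rfl⟩ := Finset.mem_image.1 hi
                simp only [Finset.mem_filter] at hx
                have := dist_triangle (pos x.2) (pos x.1) c
                rw [dist_comm (pos x.2) (pos x.1), dist_eq_norm (pos x.1) (pos x.2), ← pos_sub,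
                  hx.1.2] at this
                linarith [hx.2.2]
              · intro i hi
                obtain ⟨x, hx, rfl⟩ := Finset.mem_image.1 hi
                exact (Finset.mem_filter.1 hx).2.1
            · rintro x hx y hy hxy
              simp only [Finset.coe_filter, Set.mem_ofPred_eq, Finset.mem_filter] at hx hy
              refine Prod.ext hxy ?_
              have := hx.1.2.trans hy.1.2.symm
              rw [hxy] at this
              exact sub_right_injective this
        _ = 3 * 4 ^ d * d * R ^ (d - 1) * (1 / ‖pos v‖ ^ (α - 1)) := by
            rw [Real.rpow_sub hv0, Real.rpow_one]
            field_simp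
    · refine le_of_eq (Finset.sum_eq_zero fun x hx => if_neg ?_)
      rw [← pos_sub, (Finset.mem_filter.1 hx).2]
      tauto
  rw [← Finset.sum_product', ← Finset.sum_fiberwise_of_maps_to
    (fun x hx => Finset.mem_image_of_mem (fun x => x.1 - x.2) hx)]
  calc _ ≤ ∑ v ∈ V, if ℓ < ‖pos v‖ then
          3 * 4 ^ d * d * R ^ (d - 1) * (1 / ‖pos v‖ ^ (α - 1)) else 0 :=
        Finset.sum_le_sum fun v _ => h1 v
    _ = 3 * 4 ^ d * d * R ^ (d - 1) * ∑ v ∈ V with ℓ < ‖pos v‖, 1 / ‖pos v‖ ^ (α - 1) := by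
        rw [← Finset.sum_filter, Finset.mul_sum]
    _ ≤ 3 * 4 ^ d * d * R ^ (d - 1) * (K * ℓ ^ ((d : ℝ) - (α - 1))) := by
        refine mul_le_mul_of_nonneg_left ?_ (by positivity)
        exact hK _ ℓ (by linarith) fun v hv => (Finset.mem_filter.1 hv).2
    _ = 3 * 4 ^ d * d * K * R ^ (d - 1) * ℓ ^ ((d : ℝ) + 1 - α) := by
        rw [show (d : ℝ) - (α - 1) = d + 1 - α by ring]
        ring

/-- The total strength of the couplings of length more than `ℓ` at a site. -/
theorem exists_sum_site_le {d : ℕ} (hd : 1 ≤ d) {α : ℝ} (hα : (d : ℝ) < α) :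
    ∃ K : ℝ, 0 < K ∧ ∀ (Λ : Finset (Fin d → ℤ)) (i : Fin d → ℤ) (ℓ : ℝ), 1 / 2 ≤ ℓ →
      ∑ j ∈ Λ, (if ℓ < ‖pos i - pos j‖ then 1 / ‖pos i - pos j‖ ^ α else 0) ≤
        K * ℓ ^ ((d : ℝ) - α) := by
  obtain ⟨K, hK0, hK⟩ := exists_sum_rpow_le hd hα
  refine ⟨K, hK0, fun Λ i ℓ hℓ => ?_⟩
  rw [← Finset.sum_filter]
  refine le_trans (le_of_eq ?_) (hK ((Λ.filter fun j => ℓ < ‖pos i - pos j‖).image fun j => i - j)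
    ℓ hℓ ?_)
  · rw [Finset.sum_image (fun x _ y _ h => sub_right_injective h)]
    simp only [pos_sub]
  · intro v hv
    obtain ⟨j, hj, rfl⟩ := Finset.mem_image.1 hv
    rw [pos_sub]
    exact (Finset.mem_filter.1 hj).2

/-! ### Supports of operators -/

section Support

variable {d : ℕ} {Λ : Finset (Fin d → ℤ)}

theorem SupportedOn.mono {M : Op Λ} {S T : Finset Λ} (hM : SupportedOn M S) (h : S ⊆ T) :
    SupportedOn M T := by
  obtain ⟨N, rfl⟩ := hM
  -- The witness is `N` tensored with the identity on `T \ S`.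
  refine ⟨Matrix.of fun u w => if ∀ i : {i : Λ // i ∈ T}, (i : Λ) ∉ S → u i = w i then
    N (fun i => u ⟨i, h i.2⟩) (fun i => w ⟨i, h i.2⟩) else 0, ?_⟩
  ext x y
  simp only [Matrix.submatrix_apply, Matrix.kroneckerMap_apply, Matrix.one_apply, Matrix.of_apply,
    Equiv.piEquivPiSubtypeProd_apply, funext_iff, Subtype.forall]
  by_cases h1 : ∀ i : Λ, i ∉ S → x i = y i
  · rw [if_pos fun a ha hb => h1 ⟨a, ha⟩ hb, if_pos fun a ha _ hb => h1 ⟨a, ha⟩ hb,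
      if_pos fun a ha hb => h1 ⟨a, ha⟩ fun hc => hb (h hc)]
  · rw [if_neg fun hc => h1 fun i hi => hc i i.2 hi, mul_zero]
    by_cases h2 : ∀ i : Λ, i ∉ T → x i = y i
    · rw [if_neg, zero_mul]
      intro hc
      refine h1 fun i hi => ?_
      by_cases hT : i ∈ T
      · exact hc i i.2 hT hi
      · exact h2 i hT
    · rw [if_neg (show ¬ ∀ (a : Fin d → ℤ) (b : a ∈ Λ), (⟨a, b⟩ : Λ) ∉ T → x ⟨a, b⟩ = y ⟨a, b⟩ from
        fun hc => h2 fun i hi => hc i i.2 hi), mul_zero]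

theorem SupportedOn.mul {M M' : Op Λ} {S : Finset Λ} (hM : SupportedOn M S)
    (hM' : SupportedOn M' S) : SupportedOn (M * M') S := by
  obtain ⟨N, rfl⟩ := hM
  obtain ⟨N', rfl⟩ := hM'
  exact ⟨N * N', by rw [Matrix.submatrix_mul_equiv, ← Matrix.mul_kronecker_mul, one_mul]⟩

theorem SupportedOn.add {M M' : Op Λ} {S : Finset Λ} (hM : SupportedOn M S)
    (hM' : SupportedOn M' S) : SupportedOn (M + M') S := by
  obtain ⟨N, rfl⟩ := hM
  obtain ⟨N', rfl⟩ := hM'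
  exact ⟨N + N', by rw [Matrix.add_kronecker]; rfl⟩

theorem SupportedOn.neg {M : Op Λ} {S : Finset Λ} (hM : SupportedOn M S) :
    SupportedOn (-M) S := by
  obtain ⟨N, rfl⟩ := hM
  exact ⟨-N, by ext; simp⟩

theorem SupportedOn.sub {M M' : Op Λ} {S : Finset Λ} (hM : SupportedOn M S)
    (hM' : SupportedOn M' S) : SupportedOn (M - M') S := by
  rw [sub_eq_add_neg]
  exact hM.add hM'.neg

theorem SupportedOn.zero (S : Finset Λ) : SupportedOn (0 : Op Λ) S :=
  ⟨0, by rw [Matrix.zero_kronecker]; rfl⟩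

theorem SupportedOn.sum {ι : Type*} {s : Finset ι} {f : ι → Op Λ} {S : Finset Λ}
    (h : ∀ k ∈ s, SupportedOn (f k) S) : SupportedOn (∑ k ∈ s, f k) S :=
  Finset.sum_induction f (fun M => SupportedOn M S) (fun _ _ => SupportedOn.add)
    (SupportedOn.zero S) h

/-- As `T` avoids `S`, the operator `M'` has the form `1 ⊗ N''` in the factorization belonging to
`S`, while `M` has the form `N ⊗ 1`. -/
theorem SupportedOn.commute {M M' : Op Λ} {S T : Finset Λ} (hM : SupportedOn M S)
    (hM' : SupportedOn M' T) (h : Disjoint S T) : Commute M M' := by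
  obtain ⟨N', rfl⟩ := hM'
  have hT : ∀ i : {i : Λ // i ∈ T}, (i : Λ) ∉ S := fun i hi => Finset.disjoint_left.1 h hi i.2
  have key : (N' ⊗ₖ (1 : Matrix ({i : Λ // i ∉ T} → Fin 2) ({i : Λ // i ∉ T} → Fin 2) ℂ)).submatrix
      (Equiv.piEquivPiSubtypeProd (fun i : Λ => i ∈ T) (fun _ => Fin 2))
      (Equiv.piEquivPiSubtypeProd (fun i : Λ => i ∈ T) (fun _ => Fin 2)) =
      ((1 : Matrix ({i : Λ // i ∈ S} → Fin 2) ({i : Λ // i ∈ S} → Fin 2) ℂ) ⊗ₖ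
        (Matrix.of fun u w : {i : Λ // i ∉ S} → Fin 2 =>
          if ∀ i : {i : Λ // i ∉ S}, (i : Λ) ∉ T → u i = w i then
            N' (fun i => u ⟨i, hT i⟩) (fun i => w ⟨i, hT i⟩) else 0)).submatrix
      (Equiv.piEquivPiSubtypeProd (fun i : Λ => i ∈ S) (fun _ => Fin 2))
      (Equiv.piEquivPiSubtypeProd (fun i : Λ => i ∈ S) (fun _ => Fin 2)) := by
    ext x y
    simp only [Matrix.submatrix_apply, Matrix.kroneckerMap_apply, Matrix.one_apply, Matrix.of_apply,
      Equiv.piEquivPiSubtypeProd_apply, funext_iff, Subtype.forall]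
    by_cases h1 : ∀ i : Λ, i ∉ T → x i = y i
    · rw [if_pos fun a ha hb => h1 ⟨a, ha⟩ hb, if_pos fun a ha _ hb => h1 ⟨a, ha⟩ hb,
        if_pos fun a ha hb => h1 ⟨a, ha⟩ (Finset.disjoint_left.1 h hb), mul_one, one_mul]
    · rw [if_neg fun hc => h1 fun i hi => hc i i.2 hi, mul_zero]
      by_cases h2 : ∀ i : Λ, i ∈ S → x i = y i
      · rw [if_neg (show ¬ ∀ (a : Fin d → ℤ) (b : a ∈ Λ), (⟨a, b⟩ : Λ) ∉ S → (⟨a, b⟩ : Λ) ∉ T →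
          x ⟨a, b⟩ = y ⟨a, b⟩ from fun hc => h1 fun i hi => ?_), mul_zero]
        by_cases hS : i ∈ S
        · exact h2 i hS
        · exact hc i i.2 hS hi
      · rw [if_neg (show ¬ ∀ (a : Fin d → ℤ) (b : a ∈ Λ), (⟨a, b⟩ : Λ) ∈ S → x ⟨a, b⟩ = y ⟨a, b⟩ from
          fun hc => h2 fun i hi => hc i i.2 hi), zero_mul]
  obtain ⟨N, rfl⟩ := hM
  rw [key, Commute, SemiconjBy, Matrix.submatrix_mul_equiv, Matrix.submatrix_mul_equiv,
    ← Matrix.mul_kronecker_mul, ← Matrix.mul_kronecker_mul, one_mul, mul_one, one_mul, mul_one]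

end Support

/-! ### Time evolution -/

section Evolve

variable {n : Type} [Fintype n] [DecidableEq n] {H K : Matrix n n ℂ}

theorem exp_mem_unitary (hH : H.IsHermitian) (t : ℝ) :
    NormedSpace.exp ((Complex.I * (t : ℂ)) • H) ∈ unitary (Matrix n n ℂ) := by
  let : NormedAlgebra ℚ (Matrix n n ℂ) := NormedAlgebra.restrictScalars ℚ ℂ _
  refine NormedSpace.exp_mem_unitary_of_mem_skewAdjoint ?_
  rw [skewAdjoint.mem_iff, star_smul, Matrix.star_eq_conjTranspose, hH.eq]
  simp

theorem exp_neg_mem_unitary (hH : H.IsHermitian) (t : ℝ) :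
    NormedSpace.exp ((-(Complex.I * (t : ℂ))) • H) ∈ unitary (Matrix n n ℂ) := by
  simpa using exp_mem_unitary hH (-t)

theorem norm_evolve (hH : H.IsHermitian) (A : Matrix n n ℂ) (t : ℝ) :
    ‖evolve H A t‖ = ‖A‖ := by
  rw [evolve, CStarRing.norm_mul_mem_unitary _ (exp_neg_mem_unitary hH t),
    CStarRing.norm_mem_unitary_mul _ (exp_mem_unitary hH t)]

theorem exp_mul_exp_neg (H : Matrix n n ℂ) (z : ℂ) :
    NormedSpace.exp (z • H) * NormedSpace.exp ((-z) • H) = 1 := by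
  let : NormedAlgebra ℚ (Matrix n n ℂ) := NormedAlgebra.restrictScalars ℚ ℂ _
  rw [← NormedSpace.exp_add_of_commute (((Commute.refl H).smul_left _).smul_right _), ← add_smul,
    add_neg_cancel, zero_smul, NormedSpace.exp_zero]

theorem exp_neg_mul_exp (H : Matrix n n ℂ) (z : ℂ) :
    NormedSpace.exp ((-z) • H) * NormedSpace.exp (z • H) = 1 := by
  simpa using exp_mul_exp_neg H (-z)

@[simp]
theorem evolve_zero (H A : Matrix n n ℂ) : evolve H A 0 = A := by
  simp [evolve]

theorem evolve_sub (H A B : Matrix n n ℂ) (t : ℝ) :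
    evolve H (A - B) t = evolve H A t - evolve H B t := by
  simp only [evolve, mul_sub, sub_mul]

theorem evolve_sum {ι : Type*} (s : Finset ι) (f : ι → Matrix n n ℂ) (H : Matrix n n ℂ) (t : ℝ) :
    evolve H (∑ k ∈ s, f k) t = ∑ k ∈ s, evolve H (f k) t := by
  simp only [evolve, Finset.mul_sum, Finset.sum_mul]

theorem evolve_smul (z : ℂ) (H A : Matrix n n ℂ) (t : ℝ) :
    evolve H (z • A) t = z • evolve H A t := by
  simp only [evolve, mul_smul_comm, smul_mul_assoc]

theorem evolve_mul (H A B : Matrix n n ℂ) (t : ℝ) :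
    evolve H (A * B) t = evolve H A t * evolve H B t := by
  have h := exp_neg_mul_exp H (Complex.I * (t : ℂ))
  simp only [evolve, mul_assoc]
  rw [← mul_assoc (NormedSpace.exp (-(Complex.I * (t : ℂ)) • H))
    (NormedSpace.exp ((Complex.I * (t : ℂ)) • H)), h, one_mul]

theorem evolve_add (H A : Matrix n n ℂ) (s t : ℝ) :
    evolve H A (s + t) = evolve H (evolve H A s) t := by
  let : NormedAlgebra ℚ (Matrix n n ℂ) := NormedAlgebra.restrictScalars ℚ ℂ _
  have h : ∀ z w : ℂ, NormedSpace.exp ((z + w) • H) =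
      NormedSpace.exp (z • H) * NormedSpace.exp (w • H) := fun z w => by
    rw [← NormedSpace.exp_add_of_commute (((Commute.refl H).smul_left _).smul_right _), add_smul]
  simp only [evolve]
  rw [show Complex.I * ((s + t : ℝ) : ℂ) = Complex.I * t + Complex.I * s by push_cast; ring, h,
    show -(Complex.I * (t : ℂ) + Complex.I * s) = -(Complex.I * s) + -(Complex.I * t) by ring, h]
  simp only [mul_assoc]

theorem commute_evolve {X A : Matrix n n ℂ} (hX : Commute X H) (hA : Commute X A) (t : ℝ) :
    Commute X (evolve H A t) :=
  (((hX.smul_right _).exp_right).mul_right hA).mul_right ((hX.smul_right _).exp_right)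

theorem hasDerivAt_exp_mul (H : Matrix n n ℂ) (z : ℂ) (t : ℝ) :
    HasDerivAt (fun t : ℝ => NormedSpace.exp ((z * (t : ℂ)) • H))
      (NormedSpace.exp ((z * (t : ℂ)) • H) * (z • H)) t := by
  have h := hasDerivAt_exp_smul_const (𝕂 := ℝ) (z • H) t
  have e : ∀ t : ℝ, (z * (t : ℂ)) • H = t • z • H := fun t => by
    rw [← Complex.coe_smul, smul_smul, mul_comm]
  simpa only [e] using h

theorem hasDerivAt_evolve (H A : Matrix n n ℂ) (t : ℝ) :
    HasDerivAt (fun t => evolve H A t) (evolve H (Complex.I • (H * A - A * H)) t) t := by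
  have h1 := hasDerivAt_exp_mul H Complex.I t
  have h2 := hasDerivAt_exp_mul H (-Complex.I) t
  simp only [neg_mul] at h2
  have h3 := (h1.mul_const A).mul h2
  refine h3.congr_deriv ?_
  have hc : Commute (-Complex.I • H) (NormedSpace.exp (-(Complex.I * (t : ℂ)) • H)) :=
    (((Commute.refl H).smul_left _).smul_right _).exp_right
  rw [← hc.eq, evolve]
  generalize NormedSpace.exp ((Complex.I * (t : ℂ)) • H) = U
  generalize NormedSpace.exp (-(Complex.I * (t : ℂ)) • H) = V
  simp only [smul_sub, mul_sub, sub_mul, mul_assoc, smul_mul_assoc, mul_smul_comm, neg_smul,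
    mul_neg, neg_mul]
  abel

/-- Conjugation by a unitary moves the evolution from the large observable `B` to the local term
`X`, with time reversed. -/
theorem norm_commutator_evolve (hH : H.IsHermitian) (X B : Matrix n n ℂ) (t : ℝ) :
    ‖X * evolve H B t - evolve H B t * X‖ =
      ‖evolve H X (-t) * B - B * evolve H X (-t)‖ := by
  have h : evolve H (evolve H X (-t)) t = X := by
    rw [← evolve_add, neg_add_cancel, evolve_zero]
  rw [← norm_evolve hH (evolve H X (-t) * B - B * evolve H X (-t)) t, evolve_sub, evolve_mul,
    evolve_mul, h]

/-- Duhamel's estimate for the difference of two time evolutions. -/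
theorem norm_evolve_sub_evolve_le (hH : H.IsHermitian) (B : Matrix n n ℂ)
    {τ D : ℝ} (hτ : 0 ≤ τ)
    (h : ∀ s, 0 ≤ s → s ≤ τ → ‖(H - K) * evolve K B s - evolve K B s * (H - K)‖ ≤ D) :
    ‖evolve H B τ - evolve K B τ‖ ≤ τ * D := by
  -- `G` compares the two evolutions: it is constant when `H = K`, and in general its derivative is
  -- a conjugated commutator with `H - K`.
  set G : ℝ → Matrix n n ℂ := fun s => evolve H (evolve K B s) (-s) with hG
  have hderiv : ∀ s, HasDerivAt G (evolve H (-Complex.I •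
      ((H - K) * evolve K B s - evolve K B s * (H - K))) (-s)) s := by
    intro s
    have h1 := hasDerivAt_exp_mul H (-Complex.I) s
    have h2 := hasDerivAt_exp_mul H Complex.I s
    have h3 := (h1.mul (hasDerivAt_evolve K B s)).mul h2
    have hGe : G = (fun s : ℝ => NormedSpace.exp ((-Complex.I * (s : ℂ)) • H)) *
        (fun s => evolve K B s) * fun s : ℝ => NormedSpace.exp ((Complex.I * (s : ℂ)) • H) := by
      ext1 s
      simp [hG, evolve]
    rw [hGe]
    refine h3.congr_deriv ?_
    have hc : Commute (Complex.I • H) (NormedSpace.exp ((Complex.I * (s : ℂ)) • H)) :=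
      (((Commute.refl H).smul_left _).smul_right _).exp_right
    rw [← hc.eq]
    have hcK : Commute K (NormedSpace.exp ((Complex.I * (s : ℂ)) • K)) :=
      ((Commute.refl K).smul_right _).exp_right
    have hK' : evolve K (Complex.I • (K * B - B * K)) s =
        Complex.I • (K * evolve K B s - evolve K B s * K) := by
      have hKK : evolve K K s = K := by
        rw [evolve, ← hcK.eq, mul_assoc, exp_mul_exp_neg, mul_one]
      rw [evolve_smul, evolve_sub, evolve_mul, evolve_mul, hKK]
    rw [hK']
    simp only [Pi.mul_apply]
    generalize evolve K B s = Y
    have h5 : Complex.I * ((-s : ℝ) : ℂ) = -Complex.I * s := by push_cast; ring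
    have h6 : -(-Complex.I * (s : ℂ)) = Complex.I * s := by ring
    rw [evolve, h5, h6]
    generalize NormedSpace.exp ((-Complex.I * (s : ℂ)) • H) = U
    generalize NormedSpace.exp ((Complex.I * (s : ℂ)) • H) = V
    simp only [smul_sub, mul_sub, sub_mul, add_mul, mul_assoc, smul_mul_assoc,
      mul_smul_comm, neg_smul, mul_neg, neg_mul]
    abel
  have hb : ‖G τ - G 0‖ ≤ D * ‖τ - 0‖ := by
    refine Convex.norm_image_sub_le_of_norm_hasDerivWithin_le (s := Set.Icc 0 τ)
      (fun s _ => (hderiv s).hasDerivWithinAt) (fun s hs => ?_) (convex_Icc 0 τ) ⟨le_rfl, hτ⟩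
      ⟨hτ, le_rfl⟩
    rw [norm_evolve hH, norm_smul, norm_neg, Complex.norm_I, one_mul]
    exact h s hs.1 hs.2
  have hG0 : G 0 = B := by simp [hG]
  have h7 : evolve H (G τ - G 0) τ = evolve K B τ - evolve H B τ := by
    rw [hG0, evolve_sub]
    simp only [hG]
    rw [← evolve_add, neg_add_cancel, evolve_zero]
  rw [norm_sub_rev, ← h7, norm_evolve hH]
  rwa [sub_zero, Real.norm_of_nonneg hτ, mul_comm] at hb

end Evolve

/-! ### Power-law couplings -/

/-- The bound on the norm of the term of a power-law Hamiltonian at the sites `i` and `j`. -/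
noncomputable def coupling {d : ℕ} (α : ℝ) (i j : Fin d → ℤ) : ℝ :=
  if i = j then 1 else 1 / ‖pos i - pos j‖ ^ α

theorem coupling_nonneg {d : ℕ} (α : ℝ) (i j : Fin d → ℤ) : 0 ≤ coupling α i j := by
  unfold coupling
  split_ifs <;> positivity

theorem coupling_comm {d : ℕ} (α : ℝ) (i j : Fin d → ℤ) : coupling α i j = coupling α j i := by
  simp only [coupling, norm_sub_rev (pos i), eq_comm (a := i)]

theorem coupling_of_lt {d : ℕ} {α ℓ : ℝ} (hℓ : 0 ≤ ℓ) {i j : Fin d → ℤ}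
    (h : ℓ < ‖pos i - pos j‖) : coupling α i j = 1 / ‖pos i - pos j‖ ^ α := by
  unfold coupling
  rw [if_neg]
  rintro rfl
  rw [sub_self, norm_zero] at h
  linarith

section

variable {d : ℕ} {Λ : Finset (Fin d → ℤ)} {α : ℝ} {h : Λ → Λ → Op Λ}

theorem IsPowerLaw.norm_le_coupling (hh : IsPowerLaw α h) (i j : Λ) :
    ‖h i j‖ ≤ coupling α (i : Fin d → ℤ) j := by
  unfold coupling
  split_ifs with hij
  · rw [← Subtype.ext hij]
    exact hh.norm_le_one i
  · exact hh.norm_le i j fun e => hij (congrArg _ e)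

theorem IsPowerLaw.hamiltonian_isHermitian (hh : IsPowerLaw α h) :
    (hamiltonian h).IsHermitian :=
  isSelfAdjoint_sum _ fun i _ => isSelfAdjoint_sum _ fun j _ => hh.isHermitian i j

end

theorem exists_sum_coupling_le {d : ℕ} (hd : 1 ≤ d) {α : ℝ} (hα : (d : ℝ) < α) :
    ∃ J : ℝ, 0 < J ∧ ∀ (Λ : Finset (Fin d → ℤ)) (i : Λ),
      ∑ j : Λ, coupling α (i : Fin d → ℤ) j ≤ J := by
  obtain ⟨K, hK0, hK⟩ := exists_sum_site_le hd hα
  -- The `1` is the on-site term. Distinct lattice points have distance at least `1`, so the tail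
  -- beyond `1 / 2` contains all other couplings.
  refine ⟨1 + K * (1 / 2) ^ ((d : ℝ) - α), by positivity, fun Λ i => ?_⟩
  have h1 : ∀ j ∈ Λ, coupling α (i : Fin d → ℤ) j ≤ (if (i : Fin d → ℤ) = j then 1 else 0) +
      (if 1 / 2 < ‖pos (i : Fin d → ℤ) - pos j‖ then 1 / ‖pos (i : Fin d → ℤ) - pos j‖ ^ α
        else 0) := by
    intro j _
    by_cases hij : (i : Fin d → ℤ) = j
    · rw [coupling, if_pos hij, if_pos hij]
      have : 0 ≤ (if 1 / 2 < ‖pos (i : Fin d → ℤ) - pos j‖ then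
        1 / ‖pos (i : Fin d → ℤ) - pos j‖ ^ α else 0) := by split_ifs <;> positivity
      linarith
    · have := one_le_dist_pos hij
      rw [dist_eq_norm] at this
      rw [coupling, if_neg hij, if_neg hij, if_pos (by linarith), zero_add]
  rw [Finset.sum_coe_sort Λ (fun j => coupling α (i : Fin d → ℤ) j)]
  refine (Finset.sum_le_sum h1).trans ?_
  rw [Finset.sum_add_distrib]
  refine add_le_add ?_ (hK Λ i (1 / 2) le_rfl)
  rw [Finset.sum_ite_eq, if_pos i.2]

theorem exists_sum_coupling_far_le {d : ℕ} (hd : 1 ≤ d) {α : ℝ} (hα : (d : ℝ) < α) :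
    ∃ K : ℝ, 0 < K ∧ ∀ (Λ : Finset (Fin d → ℤ)) (ℓ : ℝ), 1 ≤ ℓ → ∀ i : Λ,
      ∑ j : Λ, (if ℓ < ‖pos (i : Fin d → ℤ) - pos (j : Fin d → ℤ)‖ then
        coupling α (i : Fin d → ℤ) j else 0) ≤ K * ℓ ^ ((d : ℝ) - α) := by
  obtain ⟨K, hK0, hK⟩ := exists_sum_site_le hd hα
  refine ⟨K, hK0, fun Λ ℓ hℓ i => ?_⟩
  rw [Finset.sum_coe_sort Λ (fun j => if ℓ < ‖pos (i : Fin d → ℤ) - pos j‖ then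
    coupling α (i : Fin d → ℤ) j else 0)]
  refine le_trans (le_of_eq (Finset.sum_congr rfl fun j _ => ?_)) (hK Λ i ℓ (by linarith))
  split_ifs with hij
  · exact coupling_of_lt (by linarith) hij
  · rfl

/-! ### A Lieb–Robinson bound -/

theorem norm_commutator_le {R : Type*} [NormedRing R] (X B : R) :
    ‖X * B - B * X‖ ≤ 2 * ‖X‖ * ‖B‖ := by
  calc ‖X * B - B * X‖ ≤ ‖X * B‖ + ‖B * X‖ := norm_sub_le _ _
    _ ≤ ‖X‖ * ‖B‖ + ‖B‖ * ‖X‖ := add_le_add (norm_mul_le _ _) (norm_mul_le _ _)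
    _ = 2 * ‖X‖ * ‖B‖ := by ring

/-- The constant in the Lieb–Robinson bound `norm_evolve_commutator_le`. -/
def lrConst (J : ℝ) : ℕ → ℕ → ℝ
  | 0, _ => 2
  | k + 1, m => 4 * m * J * lrConst J k (m + 1) + 8 * m

theorem lrConst_nonneg {J : ℝ} (hJ : 0 ≤ J) (k m : ℕ) : 0 ≤ lrConst J k m := by
  induction k generalizing m with
  | zero => simp [lrConst]
  | succ k ih =>
    have := ih (m + 1)
    rw [lrConst]
    positivity

section

variable {d : ℕ} {Λ : Finset (Fin d → ℤ)}

/-- `B` commutes with all operators supported outside the ball of radius `y` around `c`. -/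
def CommutesOutside (c : EuclideanSpace ℝ (Fin d)) (y : ℝ) (B : Op Λ) : Prop :=
  ∀ (S : Finset Λ) (X : Op Λ), SupportedOn X S →
    (∀ i ∈ S, y < dist (pos (i : Fin d → ℤ)) c) → Commute X B

theorem SupportedOn.commutesOutside {c : EuclideanSpace ℝ (Fin d)} {y : ℝ} {B : Op Λ}
    (hB : SupportedOn B (ballSites Λ c y)) : CommutesOutside c y B := by
  intro S X hX hS
  refine hX.commute hB (Finset.disjoint_left.2 fun i hi hi' => ?_)
  exact absurd (Finset.mem_filter.1 hi').2 (not_le.2 (hS i hi))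

/-- Each `k` stands for one hop of length at most `ℓ`. The commutator vanishes at time `0`, and its
derivative contains only the terms of the Hamiltonian that touch `S`. A short term enlarges `S` by
at most one site, which is at most `ℓ` closer to `c`, so the bound for `k - 1` hops applies and
integration yields one more factor `σ`. Long terms are bounded trivially and contribute `ε`.
Negative times are included because `norm_commutator_evolve` reverses time. -/
theorem norm_evolve_commutator_le {α J ε ℓ y σ : ℝ} {g : Λ → Λ → Op Λ} (hg : IsPowerLaw α g)
    (hJ0 : 0 ≤ J) (hε0 : 0 ≤ ε) (hℓ : 0 ≤ ℓ)
    (hJ : ∀ i : Λ, ∑ j : Λ, coupling α (i : Fin d → ℤ) j ≤ J)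
    (hε : ∀ i : Λ, ∑ j : Λ, (if ℓ < ‖pos (i : Fin d → ℤ) - pos (j : Fin d → ℤ)‖ then
        coupling α (i : Fin d → ℤ) j else 0) ≤ ε)
    {c : EuclideanSpace ℝ (Fin d)} {B : Op Λ} (hB : CommutesOutside c y B)
    (hσ0 : 0 ≤ σ) (hσ1 : σ ≤ 1) (k : ℕ) : ∀ (m : ℕ) (S : Finset Λ) (X : Op Λ), S.card ≤ m →
      (∀ i ∈ S, y + k * ℓ < dist (pos (i : Fin d → ℤ)) c) → SupportedOn X S →
      ∀ s : ℝ, |s| ≤ σ →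
      ‖evolve (hamiltonian g) X s * B - B * evolve (hamiltonian g) X s‖ ≤
        lrConst J k m * (σ ^ k + ε) * ‖X‖ * ‖B‖ := by
  have hH := hg.hamiltonian_isHermitian
  induction k with
  | zero =>
    intro m S X _ _ _ s _
    refine (norm_commutator_le _ _).trans ?_
    rw [norm_evolve hH, lrConst, pow_zero]
    gcongr
    linarith
  | succ k ih =>
    intro m S X hSm hS hX s hs
    set D := lrConst J k (m + 1) * (σ ^ k + ε) with hD
    have hc0 := lrConst_nonneg hJ0 k (m + 1)
    have hD0 : 0 ≤ D := by positivity
    -- A short term costs `D` from the induction hypothesis times `2` from the inner commutator. A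
    -- long one costs `2 * 2` from two trivial commutator bounds.
    set w : Λ → Λ → ℝ := fun i j => 2 * D * coupling α (i : Fin d → ℤ) j +
      4 * (if ℓ < ‖pos (i : Fin d → ℤ) - pos (j : Fin d → ℤ)‖ then
        coupling α (i : Fin d → ℤ) j else 0) with hw
    have hw0 : ∀ i j, 0 ≤ w i j := fun i j => by
      have := coupling_nonneg α (i : Fin d → ℤ) j
      simp only [hw]
      split_ifs <;> positivity
    have hwc : ∀ i j, w i j = w j i := fun i j => by
      simp only [hw]
      rw [coupling_comm, norm_sub_rev]
    have hnear : ∀ u, |u| ≤ σ → ∀ i j, i ∈ S ∨ j ∈ S →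
        ‖evolve (hamiltonian g) (g i j * X - X * g i j) u * B -
          B * evolve (hamiltonian g) (g i j * X - X * g i j) u‖ ≤ w i j * (‖X‖ * ‖B‖) := by
      intro u hu i j hij
      have hY : ‖g i j * X - X * g i j‖ ≤ 2 * coupling α (i : Fin d → ℤ) j * ‖X‖ :=
        (norm_commutator_le _ _).trans (by gcongr; exact hg.norm_le_coupling i j)
      by_cases hfar : ℓ < ‖pos (i : Fin d → ℤ) - pos (j : Fin d → ℤ)‖
      · refine (norm_commutator_le _ _).trans ?_
        rw [norm_evolve hH]
        simp only [hw, if_pos hfar]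
        have := coupling_nonneg α (i : Fin d → ℤ) j
        calc _ ≤ 2 * (2 * coupling α (i : Fin d → ℤ) j * ‖X‖) * ‖B‖ := by gcongr
          _ = 0 + 4 * coupling α (i : Fin d → ℤ) j * (‖X‖ * ‖B‖) := by ring
          _ ≤ 2 * D * coupling α (i : Fin d → ℤ) j * (‖X‖ * ‖B‖) +
                4 * coupling α (i : Fin d → ℤ) j * (‖X‖ * ‖B‖) := by gcongr; positivity
          _ = _ := by ring
      · simp only [hw, if_neg hfar, mul_zero, add_zero]
        have hclose : dist (pos (i : Fin d → ℤ)) (pos (j : Fin d → ℤ)) ≤ ℓ := by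
          rw [dist_eq_norm]
          exact not_lt.1 hfar
        have hS' : ∀ i ∈ S, y + k * ℓ + ℓ < dist (pos (i : Fin d → ℤ)) c := fun i hi => by
          have := hS i hi
          push_cast at this
          linarith
        have hT : ∃ T : Finset Λ, T.card ≤ m + 1 ∧ S ⊆ T ∧ {i, j} ⊆ T ∧
            ∀ l ∈ T, y + k * ℓ < dist (pos (l : Fin d → ℤ)) c := by
          rcases hij with hi | hj
          · refine ⟨insert j S, (Finset.card_insert_le _ _).trans (by omega),
              Finset.subset_insert _ _, ?_, ?_⟩
            · intro l hl
              rcases Finset.mem_insert.1 hl with rfl | hl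
              · exact Finset.mem_insert_of_mem hi
              · rw [Finset.mem_singleton.1 hl]
                exact Finset.mem_insert_self _ _
            · intro l hl
              rcases Finset.mem_insert.1 hl with rfl | hl
              · have := hS' i hi
                have := dist_triangle (pos (i : Fin d → ℤ)) (pos (l : Fin d → ℤ)) c
                linarith
              · linarith [hS' l hl]
          · refine ⟨insert i S, (Finset.card_insert_le _ _).trans (by omega),
              Finset.subset_insert _ _, ?_, ?_⟩
            · intro l hl
              rcases Finset.mem_insert.1 hl with rfl | hl
              · exact Finset.mem_insert_self _ _
              · rw [Finset.mem_singleton.1 hl]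
                exact Finset.mem_insert_of_mem hj
            · intro l hl
              rcases Finset.mem_insert.1 hl with rfl | hl
              · have := hS' j hj
                have := dist_triangle_left (pos (j : Fin d → ℤ)) c (pos (l : Fin d → ℤ))
                linarith
              · linarith [hS' l hl]
        obtain ⟨T, hTm, hST, hijT, hTc⟩ := hT
        have hg' := (hg.supportedOn i j).mono hijT
        have hX' := hX.mono hST
        refine (ih (m + 1) T _ hTm hTc ((hg'.mul hX').sub (hX'.mul hg')) u hu).trans ?_
        calc _ ≤ D * (2 * coupling α (i : Fin d → ℤ) j * ‖X‖) * ‖B‖ := by gcongr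
          _ = _ := by ring
    -- A pair is charged to each of its endpoints in `S`, so the sum over pairs has at most `2 * m`
    -- rows rather than one for each site of `Λ`.
    have hterm : ∀ u, |u| ≤ σ → ∀ i j,
        ‖evolve (hamiltonian g) (g i j * X - X * g i j) u * B -
          B * evolve (hamiltonian g) (g i j * X - X * g i j) u‖ ≤
        ((if i ∈ S then w i j else 0) + (if j ∈ S then w i j else 0)) * (‖X‖ * ‖B‖) := by
      intro u hu i j
      by_cases hij : i ∈ S ∨ j ∈ S
      · refine (hnear u hu i j hij).trans (mul_le_mul_of_nonneg_right ?_ (by positivity))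
        have := hw0 i j
        rcases hij with hi | hj
        · rw [if_pos hi]
          split_ifs <;> linarith
        · rw [if_pos hj]
          split_ifs <;> linarith
      · push Not at hij
        have hc : Commute (g i j) X := (hg.supportedOn i j).commute hX <| by
          rw [Finset.disjoint_left]
          intro l hl
          rcases Finset.mem_insert.1 hl with rfl | hl
          · exact hij.1
          · rw [Finset.mem_singleton.1 hl]
            exact hij.2
        rw [hc.eq, sub_self, if_neg hij.1, if_neg hij.2]
        simp [evolve]
    have hsum : ∑ i, ∑ j, ((if i ∈ S then w i j else 0) + (if j ∈ S then w i j else 0)) ≤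
        2 * (m * (2 * D * J + 4 * ε)) := by
      simp only [Finset.sum_add_distrib]
      rw [Finset.sum_comm (f := fun i j => if j ∈ S then w i j else 0)]
      have h1 : ∑ i, ∑ j, (if i ∈ S then w i j else 0) ≤ m * (2 * D * J + 4 * ε) := by
        calc ∑ i, ∑ j, (if i ∈ S then w i j else 0) = ∑ i ∈ S, ∑ j, w i j := by
              rw [← Finset.sum_subset (Finset.subset_univ S)]
              · exact Finset.sum_congr rfl fun i hi => by simp only [if_pos hi]
              · exact fun i _ hi => by simp only [if_neg hi, Finset.sum_const_zero]
          _ ≤ ∑ i ∈ S, (2 * D * J + 4 * ε) := by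
              refine Finset.sum_le_sum fun i _ => ?_
              simp only [hw, Finset.sum_add_distrib, ← Finset.mul_sum]
              have := hJ i
              have := hε i
              gcongr
          _ = S.card * (2 * D * J + 4 * ε) := by rw [Finset.sum_const, nsmul_eq_mul]
          _ ≤ m * (2 * D * J + 4 * ε) := by gcongr
      have h2 : ∑ j, ∑ i, (if j ∈ S then w i j else 0) ≤ m * (2 * D * J + 4 * ε) := by
        refine le_trans (le_of_eq ?_) h1
        refine Finset.sum_congr rfl fun j _ => Finset.sum_congr rfl fun i _ => ?_
        rw [hwc i j]
      linarith
    have hderiv : ∀ u, |u| ≤ σ →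
        ‖evolve (hamiltonian g) (Complex.I • (hamiltonian g * X - X * hamiltonian g)) u * B -
          B * evolve (hamiltonian g) (Complex.I • (hamiltonian g * X - X * hamiltonian g)) u‖ ≤
        2 * (m * (2 * D * J + 4 * ε)) * (‖X‖ * ‖B‖) := by
      intro u hu
      have hexp : hamiltonian g * X - X * hamiltonian g =
          ∑ i, ∑ j, (g i j * X - X * g i j) := by
        simp only [hamiltonian, Finset.sum_mul, Finset.mul_sum, Finset.sum_sub_distrib]
      rw [evolve_smul, smul_mul_assoc, mul_smul_comm, ← smul_sub, norm_smul, Complex.norm_I,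
        one_mul, hexp]
      simp only [evolve_sum]
      simp only [Finset.sum_mul, Finset.mul_sum, ← Finset.sum_sub_distrib]
      calc _ ≤ ∑ i, ∑ j, ((if i ∈ S then w i j else 0) + (if j ∈ S then w i j else 0)) *
            (‖X‖ * ‖B‖) :=
            norm_sum_le_of_le _ fun i _ => norm_sum_le_of_le _ fun j _ => hterm u hu i j
        _ = (∑ i, ∑ j, ((if i ∈ S then w i j else 0) + (if j ∈ S then w i j else 0))) *
            (‖X‖ * ‖B‖) := by simp only [Finset.sum_mul]
        _ ≤ _ := mul_le_mul_of_nonneg_right hsum (by positivity)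
    have hcomm : Commute X B := hB S X hX fun i hi => by
      have := hS i hi
      have : 0 ≤ ((k + 1 : ℕ) : ℝ) * ℓ := by positivity
      linarith
    have hmv : ‖(evolve (hamiltonian g) X s * B - B * evolve (hamiltonian g) X s) -
        (evolve (hamiltonian g) X 0 * B - B * evolve (hamiltonian g) X 0)‖ ≤
        2 * (m * (2 * D * J + 4 * ε)) * (‖X‖ * ‖B‖) * ‖s - 0‖ := by
      refine Convex.norm_image_sub_le_of_norm_hasDerivWithin_le (s := Set.Icc (-σ) σ)
        (f := fun s => evolve (hamiltonian g) X s * B - B * evolve (hamiltonian g) X s)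
        (fun u _ => (((hasDerivAt_evolve (hamiltonian g) X u).mul_const B).sub
          ((hasDerivAt_evolve (hamiltonian g) X u).const_mul B)).hasDerivWithinAt)
        (fun u hu => hderiv u (abs_le.2 hu)) (convex_Icc _ _) ⟨by linarith, hσ0⟩ (abs_le.1 hs)
    rw [evolve_zero, hcomm.eq, sub_self, sub_zero, sub_zero, Real.norm_eq_abs] at hmv
    refine hmv.trans ?_
    -- This is where the recursion of `lrConst` comes from. The factor `σ` raises the power by one
    -- and is discarded on `ε`, as `σ ≤ 1`.
    have h1 : 2 * (m * (2 * D * J + 4 * ε)) * σ ≤ lrConst J (k + 1) m * (σ ^ (k + 1) + ε) := by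
      have h3 : σ * ε ≤ ε := mul_le_of_le_one_left hε0 hσ1
      have h4 : 0 ≤ σ ^ (k + 1) := by positivity
      calc 2 * (m * (2 * D * J + 4 * ε)) * σ
          = 4 * m * J * lrConst J k (m + 1) * (σ ^ (k + 1) + σ * ε) + 8 * m * (σ * ε) := by
            rw [hD]; ring
        _ ≤ 4 * m * J * lrConst J k (m + 1) * (σ ^ (k + 1) + ε) +
            8 * m * (σ ^ (k + 1) + ε) := by gcongr; linarith
        _ = lrConst J (k + 1) m * (σ ^ (k + 1) + ε) := by rw [lrConst]; ring
    calc 2 * (m * (2 * D * J + 4 * ε)) * (‖X‖ * ‖B‖) * |s|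
        ≤ 2 * (m * (2 * D * J + 4 * ε)) * (‖X‖ * ‖B‖) * σ := by gcongr
      _ = 2 * (m * (2 * D * J + 4 * ε)) * σ * (‖X‖ * ‖B‖) := by ring
      _ ≤ lrConst J (k + 1) m * (σ ^ (k + 1) + ε) * (‖X‖ * ‖B‖) := by gcongr
      _ = _ := by ring

end

/-! ### Restriction of the Hamiltonian to a ball -/

section

variable {d : ℕ} {Λ : Finset (Fin d → ℤ)}

/-- The terms of a Hamiltonian both of whose sites lie in the ball of radius `R` around `c`. -/
noncomputable def restrictBall (h : Λ → Λ → Op Λ) (c : EuclideanSpace ℝ (Fin d)) (R : ℝ)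
    (i j : Λ) : Op Λ :=
  if i ∈ ballSites Λ c R ∧ j ∈ ballSites Λ c R then h i j else 0

theorem mem_ballSites {c : EuclideanSpace ℝ (Fin d)} {R : ℝ} {i : Λ} :
    i ∈ ballSites Λ c R ↔ dist (pos (i : Fin d → ℤ)) c ≤ R := by
  simp [ballSites]

theorem ballSites_subset (c : EuclideanSpace ℝ (Fin d)) {R R' : ℝ} (hR : R ≤ R') :
    ballSites Λ c R ⊆ ballSites Λ c R' := fun _ hi =>
  mem_ballSites.2 ((mem_ballSites.1 hi).trans hR)

theorem lightConeHamiltonian_eq (h : Λ → Λ → Op Λ) (c : EuclideanSpace ℝ (Fin d)) (x₀ y : ℝ) :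
    lightConeHamiltonian h c x₀ y = hamiltonian (restrictBall h c (x₀ + y)) := by
  simp only [lightConeHamiltonian, hamiltonian, restrictBall, ite_and]
  rw [← Finset.sum_subset (Finset.subset_univ (ballSites Λ c (x₀ + y)))]
  · refine Finset.sum_congr rfl fun i hi => ?_
    simp only [if_pos hi]
    rw [← Finset.sum_subset (Finset.subset_univ (ballSites Λ c (x₀ + y)))]
    · exact Finset.sum_congr rfl fun j hj => (if_pos hj).symm
    · exact fun j _ hj => if_neg hj
  · exact fun i _ hi => by simp only [if_neg hi, Finset.sum_const_zero]

theorem restrictBall_restrictBall (h : Λ → Λ → Op Λ) (c : EuclideanSpace ℝ (Fin d)) {R R' : ℝ}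
    (hR : R ≤ R') : restrictBall (restrictBall h c R') c R = restrictBall h c R := by
  ext1 i
  ext1 j
  unfold restrictBall
  have := @ballSites_subset d Λ c R R' hR
  split_ifs with h1 h2
  · rfl
  · exact absurd ⟨this h1.1, this h1.2⟩ h2
  · rfl

theorem IsPowerLaw.restrictBall {α : ℝ} {h : Λ → Λ → Op Λ} (hh : IsPowerLaw α h)
    (c : EuclideanSpace ℝ (Fin d)) (R : ℝ) : IsPowerLaw α (restrictBall h c R) where
  isHermitian i j := by
    unfold LocalObs.restrictBall
    split_ifs
    · exact hh.isHermitian i j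
    · exact Matrix.isHermitian_zero
  supportedOn i j := by
    unfold LocalObs.restrictBall
    split_ifs
    · exact hh.supportedOn i j
    · exact SupportedOn.zero _
  norm_le_one i := by
    unfold LocalObs.restrictBall
    split_ifs
    · exact hh.norm_le_one i
    · simp
  norm_le i j hij := by
    unfold LocalObs.restrictBall
    split_ifs
    · exact hh.norm_le i j hij
    · rw [norm_zero]; positivity

theorem IsPowerLaw.supportedOn_restrictBall {α : ℝ} {h : Λ → Λ → Op Λ} (hh : IsPowerLaw α h)
    (c : EuclideanSpace ℝ (Fin d)) (R : ℝ) :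
    SupportedOn (hamiltonian (LocalObs.restrictBall h c R)) (ballSites Λ c R) := by
  refine SupportedOn.sum fun i _ => SupportedOn.sum fun j _ => ?_
  unfold LocalObs.restrictBall
  split_ifs with hij
  · refine (hh.supportedOn i j).mono fun l hl => ?_
    rcases Finset.mem_insert.1 hl with rfl | hl
    · exact hij.1
    · rw [Finset.mem_singleton.1 hl]
      exact hij.2
  · exact SupportedOn.zero _

/-- The restricted Hamiltonian and `B` both commute with everything outside radius `R`, and
commutants are stable under exponentials and products. Stating localization through commutation
avoids a tensor factorization of the evolved operator. -/
theorem CommutesOutside.evolve_restrictBall {α : ℝ} {h : Λ → Λ → Op Λ} (hh : IsPowerLaw α h)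
    {c : EuclideanSpace ℝ (Fin d)} {y R : ℝ} {B : Op Λ} (hB : CommutesOutside c y B) (hR : y ≤ R)
    (s : ℝ) : CommutesOutside c R (evolve (hamiltonian (restrictBall h c R)) B s) :=
  fun S X hX hS => commute_evolve ((hh.supportedOn_restrictBall c R).commutesOutside S X hX hS)
    (hB S X hX fun i hi => hR.trans_lt (hS i hi)) s

end

/-- The coupling of `i` and `j` if `i` lies in the ball of radius `R` around `c` and `j` does not. -/
noncomputable def crossing {d : ℕ} (α : ℝ) (c : EuclideanSpace ℝ (Fin d)) (R : ℝ)
    (i j : Fin d → ℤ) : ℝ :=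
  if dist (pos i) c ≤ R ∧ R < dist (pos j) c then coupling α i j else 0

theorem crossing_nonneg {d : ℕ} (α : ℝ) (c : EuclideanSpace ℝ (Fin d)) (R : ℝ)
    (i j : Fin d → ℤ) : 0 ≤ crossing α c R i j := by
  unfold crossing
  split_ifs
  · exact coupling_nonneg α i j
  · exact le_rfl

theorem exists_sum_crossing_far_le {d : ℕ} (hd : 1 ≤ d) {α : ℝ} (hα : (d : ℝ) + 1 < α) :
    ∃ K : ℝ, 0 < K ∧ ∀ (Λ : Finset (Fin d → ℤ)) (c : EuclideanSpace ℝ (Fin d)) (R ℓ : ℝ),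
      1 ≤ R → 1 ≤ ℓ →
      ∑ i : Λ, ∑ j : Λ, (if ℓ < ‖pos (i : Fin d → ℤ) - pos (j : Fin d → ℤ)‖
        then crossing α c R (i : Fin d → ℤ) j else 0) ≤ K * R ^ (d - 1) * ℓ ^ ((d : ℝ) + 1 - α) := by
  obtain ⟨K, hK0, hK⟩ := exists_sum_crossing_le hd hα
  refine ⟨K, hK0, fun Λ c R ℓ hR hℓ => le_trans (le_of_eq ?_) (hK Λ c R ℓ hR hℓ)⟩
  rw [← Finset.sum_coe_sort Λ]
  refine Finset.sum_congr rfl fun i _ => ?_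
  rw [← Finset.sum_coe_sort Λ]
  refine Finset.sum_congr rfl fun j _ => ?_
  unfold crossing
  split_ifs with h1 h2 h3 h3 h3 <;> first
    | exact coupling_of_lt (by linarith) h1
    | rfl
    | exact absurd ⟨h2.1, h2.2, h1⟩ h3
    | exact absurd ⟨h3.1, h3.2.1⟩ h2
    | exact absurd h3.2.2 h1

/-- The inner site of a crossing pair of length at most `ℓ` lies in a shell of width `ℓ`, and each
site has total coupling at most `J`. -/
theorem exists_sum_crossing_near_le {d : ℕ} (hd : 1 ≤ d) {α : ℝ} (hα : (d : ℝ) < α) :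
    ∃ K : ℝ, 0 < K ∧ ∀ (Λ : Finset (Fin d → ℤ)) (c : EuclideanSpace ℝ (Fin d)) (R ℓ : ℝ),
      1 ≤ R → 1 ≤ ℓ →
      ∑ i : Λ, ∑ j : Λ, (if ℓ < ‖pos (i : Fin d → ℤ) - pos (j : Fin d → ℤ)‖
        then 0 else crossing α c R (i : Fin d → ℤ) j) ≤ K * R ^ (d - 1) * ℓ := by
  obtain ⟨J, hJ0, hJ⟩ := exists_sum_coupling_le hd hα
  have hd0 : (0 : ℝ) < d := by exact_mod_cast hd
  refine ⟨3 * 4 ^ d * d * J, by positivity, fun Λ c R ℓ hR hℓ => ?_⟩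
  set T := Finset.univ.filter fun i : Λ => R - ℓ ≤ dist (pos (i : Fin d → ℤ)) c ∧
    dist (pos (i : Fin d → ℤ)) c ≤ R with hT
  have hTc : (T.card : ℝ) ≤ 3 * 4 ^ d * d * R ^ (d - 1) * ℓ := by
    rw [← Finset.card_image_of_injective T Subtype.val_injective]
    refine card_shell_le hd _ c (by linarith) (by linarith) ?_ ?_
    all_goals
      intro i hi
      obtain ⟨x, hx, rfl⟩ := Finset.mem_image.1 hi
      have := (Finset.mem_filter.1 hx).2
    exacts [this.1, this.2]
  calc _ ≤ ∑ i : Λ, if i ∈ T then J else 0 := by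
        refine Finset.sum_le_sum fun i _ => ?_
        split_ifs with hi
        · refine le_trans (Finset.sum_le_sum fun j _ => ?_) (hJ Λ i)
          unfold crossing
          split_ifs <;> first | exact le_rfl | exact coupling_nonneg _ _ _
        · refine le_of_eq (Finset.sum_eq_zero fun j _ => ?_)
          unfold crossing
          split_ifs with h1 h2
          · rfl
          · refine absurd (Finset.mem_filter.2 ⟨Finset.mem_univ _, ?_, h2.1⟩) hi
            have := dist_triangle_left (pos (j : Fin d → ℤ)) c (pos (i : Fin d → ℤ))
            rw [dist_eq_norm (pos (i : Fin d → ℤ))] at this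
            linarith [h2.2]
          · rfl
    _ = T.card * J := by rw [Finset.sum_ite_mem, Finset.univ_inter, Finset.sum_const, nsmul_eq_mul]
    _ ≤ (3 * 4 ^ d * d * R ^ (d - 1) * ℓ) * J := by gcongr
    _ = _ := by ring

/-- For a short time, the evolution of an observable that is localized in the ball of radius `y`
is generated by the restriction of the Hamiltonian to a ball of radius at least `y + (p + 1) ℓ`. -/
theorem exists_evolve_sub_restrictBall_le {d : ℕ} (hd : 1 ≤ d) {α : ℝ} (hα : (d : ℝ) + 1 < α)
    (p : ℕ) : ∃ C : ℝ, 0 < C ∧ ∀ (Λ : Finset (Fin d → ℤ)) (h : Λ → Λ → Op Λ), IsPowerLaw α h →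
      ∀ (c : EuclideanSpace ℝ (Fin d)) (y R ℓ : ℝ), 0 ≤ y → 1 ≤ ℓ → y + (p + 1) * ℓ ≤ R →
      ∀ B : Op Λ, CommutesOutside c y B → ∀ τ : ℝ, 0 ≤ τ → τ ≤ 1 →
        ‖evolve (hamiltonian h) B τ - evolve (hamiltonian (restrictBall h c R)) B τ‖ ≤
          C * ‖B‖ * (τ * R ^ (d - 1) * (ℓ ^ ((d : ℝ) + 1 - α) + ℓ * τ ^ p)) := by
  obtain ⟨J, hJ0, hJ⟩ := exists_sum_coupling_le hd (show (d : ℝ) < α by linarith)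
  obtain ⟨K, hK0, hK⟩ := exists_sum_coupling_far_le hd (show (d : ℝ) < α by linarith)
  obtain ⟨F, hF0, hF⟩ := exists_sum_crossing_far_le hd hα
  obtain ⟨N, hN0, hN⟩ := exists_sum_crossing_near_le hd (show (d : ℝ) < α by linarith)
  set L := lrConst J p 2 with hL
  have hL0 : 0 ≤ L := lrConst_nonneg hJ0.le p 2
  refine ⟨2 * L * N + 2 * L * N * K + 4 * F, by positivity, ?_⟩
  intro Λ h hh c y R ℓ hy hℓ hR B hB τ hτ0 hτ1
  have hℓ0 : 0 < ℓ := by linarith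
  have hpℓ : 0 ≤ (p : ℝ) * ℓ := by positivity
  have hR' : y + p * ℓ + ℓ ≤ R := by linarith
  have hR1 : 1 ≤ R := by linarith
  set g := restrictBall h c R with hg
  have hgp : IsPowerLaw α g := hh.restrictBall c R
  have hgH := hgp.hamiltonian_isHermitian
  set ε := K * ℓ ^ ((d : ℝ) - α) with hε
  have hε0 : 0 ≤ ε := by positivity
  set q := L * (τ ^ p + ε) with hq
  have hq0 : 0 ≤ q := by positivity
  -- Weights of crossing pairs: short ones carry the Lieb–Robinson factor `q`, long ones the trivial
  -- factor `2`.
  set u : Λ → Λ → ℝ := fun i j =>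
    q * (if ℓ < ‖pos (i : Fin d → ℤ) - pos (j : Fin d → ℤ)‖
        then 0 else crossing α c R (i : Fin d → ℤ) j) +
    2 * (if ℓ < ‖pos (i : Fin d → ℤ) - pos (j : Fin d → ℤ)‖
        then crossing α c R (i : Fin d → ℤ) j else 0) with hu
  have hu0 : ∀ i j, 0 ≤ u i j := fun i j => by
    have := crossing_nonneg α c R (i : Fin d → ℤ) j
    simp only [hu]
    split_ifs <;> positivity
  have hcross : ∀ s, 0 ≤ s → s ≤ τ → ∀ i j a b : Λ, ({a, b} : Finset Λ) = {i, j} →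
      dist (pos (a : Fin d → ℤ)) c ≤ R → R < dist (pos (b : Fin d → ℤ)) c →
      ‖h i j‖ ≤ coupling α (a : Fin d → ℤ) b →
      ‖h i j * evolve (hamiltonian g) B s - evolve (hamiltonian g) B s * h i j‖ ≤
        u a b * ‖B‖ := by
    intro s hs0 hs1 i j a b hab ha hb hn
    simp only [hu, crossing, if_pos (And.intro ha hb)]
    have hcn := coupling_nonneg α (a : Fin d → ℤ) b
    split_ifs with hfar
    · refine (norm_commutator_le _ _).trans ?_
      rw [norm_evolve hgH, mul_zero, zero_add]
      gcongr
    -- One site is outside radius `R` and the other within `ℓ` of it, so both are beyond `y + p *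
    -- ℓ`. The Lieb–Robinson bound applies with `p` hops and two sites.
    · rw [norm_commutator_evolve hgH, mul_zero, add_zero]
      have hclose := dist_triangle_left (pos (b : Fin d → ℤ)) c (pos (a : Fin d → ℤ))
      rw [dist_eq_norm (pos (a : Fin d → ℤ))] at hclose
      push Not at hfar
      refine (norm_evolve_commutator_le hgp hJ0.le hε0 hℓ0.le (hJ Λ) (hK Λ ℓ hℓ) hB hτ0 hτ1 p 2
        {a, b} (h i j) Finset.card_le_two ?_ (hab ▸ hh.supportedOn i j) (-s)
        (by rwa [abs_neg, abs_of_nonneg hs0])).trans ?_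
      · intro l hl
        rcases Finset.mem_insert.1 hl with rfl | hl
        · linarith
        · rw [Finset.mem_singleton.1 hl]
          linarith
      · gcongr
  have hterm : ∀ s, 0 ≤ s → s ≤ τ → ∀ i j : Λ,
      ‖(h i j - g i j) * evolve (hamiltonian g) B s -
        evolve (hamiltonian g) B s * (h i j - g i j)‖ ≤ (u i j + u j i) * ‖B‖ := by
    intro s hs0 hs1 i j
    have hnn : 0 ≤ (u i j + u j i) * ‖B‖ :=
      mul_nonneg (add_nonneg (hu0 i j) (hu0 j i)) (norm_nonneg B)
    by_cases hi : dist (pos (i : Fin d → ℤ)) c ≤ R <;> by_cases hj : dist (pos (j : Fin d → ℤ)) c ≤ R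
    · have : g i j = h i j := if_pos ⟨mem_ballSites.2 hi, mem_ballSites.2 hj⟩
      rw [this, sub_self, zero_mul, mul_zero, sub_self, norm_zero]
      exact hnn
    all_goals
      have h0 : g i j = 0 := if_neg fun hc => by
        have := mem_ballSites.1 hc.1
        have := mem_ballSites.1 hc.2
        contradiction
      rw [h0, sub_zero]
    · refine (hcross s hs0 hs1 i j i j rfl hi (not_le.1 hj) (hh.norm_le_coupling i j)).trans ?_
      have := hu0 j i
      gcongr
      linarith
    · refine (hcross s hs0 hs1 i j j i (Finset.pair_comm _ _) hj (not_le.1 hi)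
        (coupling_comm α (i : Fin d → ℤ) j ▸ hh.norm_le_coupling i j)).trans ?_
      have := hu0 i j
      gcongr
      linarith
    · have hc : Commute (h i j) (evolve (hamiltonian g) B s) := by
        refine hB.evolve_restrictBall hh (by linarith) s {i, j} _ (hh.supportedOn i j) ?_
        intro l hl
        rcases Finset.mem_insert.1 hl with rfl | hl
        · exact not_le.1 hi
        · rw [Finset.mem_singleton.1 hl]
          exact not_le.1 hj
      rw [hc.eq, sub_self, norm_zero]
      exact hnn
  have hsum : ∑ i, ∑ j, u i j ≤ q * (N * R ^ (d - 1) * ℓ) +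
      2 * (F * R ^ (d - 1) * ℓ ^ ((d : ℝ) + 1 - α)) := by
    simp only [hu, Finset.sum_add_distrib, ← Finset.mul_sum]
    have := hN Λ c R ℓ hR1 hℓ
    have := hF Λ c R ℓ hR1 hℓ
    gcongr
  have hsum' : ∑ i, ∑ j, (u i j + u j i) * ‖B‖ ≤ 2 * (q * (N * R ^ (d - 1) * ℓ) +
      2 * (F * R ^ (d - 1) * ℓ ^ ((d : ℝ) + 1 - α))) * ‖B‖ := by
    simp only [← Finset.sum_mul, Finset.sum_add_distrib]
    rw [Finset.sum_comm (f := fun i j => u j i), ← two_mul]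
    gcongr
  refine (norm_evolve_sub_evolve_le hh.hamiltonian_isHermitian B hτ0
    (D := 2 * (q * (N * R ^ (d - 1) * ℓ) +
      2 * (F * R ^ (d - 1) * ℓ ^ ((d : ℝ) + 1 - α))) * ‖B‖) fun s hs0 hs1 => ?_).trans ?_
  · have hexp : hamiltonian h - hamiltonian g = ∑ i, ∑ j, (h i j - g i j) := by
      simp only [hamiltonian, Finset.sum_sub_distrib]
    rw [hexp]
    simp only [Finset.sum_mul, Finset.mul_sum, ← Finset.sum_sub_distrib]
    exact (norm_sum_le_of_le _ fun i _ => norm_sum_le_of_le _ fun j _ =>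
      hterm s hs0 hs1 i j).trans hsum'
  -- Multiplied by the strength `ℓ` of the short crossing terms, the Lieb–Robinson tail has the same
  -- order as the long crossing terms.
  · have hε' : ε * ℓ = K * ℓ ^ ((d : ℝ) + 1 - α) := by
      rw [hε, mul_assoc, ← Real.rpow_add_one hℓ0.ne']
      congr 2
      ring
    have hpow : 0 ≤ ℓ ^ ((d : ℝ) + 1 - α) := by positivity
    set P := ℓ ^ ((d : ℝ) + 1 - α) with hP
    have hfin : 2 * (q * (N * ℓ) + 2 * (F * P)) ≤
        (2 * L * N + 2 * L * N * K + 4 * F) * (P + ℓ * τ ^ p) := by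
      have e1 : 2 * (q * (N * ℓ) + 2 * (F * P)) =
          2 * L * N * (ℓ * τ ^ p) + 2 * L * N * K * P + 4 * F * P := by
        calc _ = 2 * L * N * (ℓ * τ ^ p) + 2 * L * N * (ε * ℓ) + 4 * F * P := by rw [hq]; ring
          _ = _ := by rw [hε']; ring
      have e2 : 0 ≤ 2 * L * N * P + 2 * L * N * K * (ℓ * τ ^ p) + 4 * F * (ℓ * τ ^ p) := by
        positivity
      rw [e1]
      linarith
    calc _ = τ * R ^ (d - 1) * ‖B‖ * (2 * (q * (N * ℓ) + 2 * (F * P))) := by ring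
      _ ≤ τ * R ^ (d - 1) * ‖B‖ *
          ((2 * L * N + 2 * L * N * K + 4 * F) * (P + ℓ * τ ^ p)) := by gcongr
      _ = _ := by ring

/-- The errors of the single steps of an approximate time evolution add up. -/
theorem norm_evolve_sub_step_le {d : ℕ} {Λ : Finset (Fin d → ℤ)} {h : Λ → Λ → Op Λ}
    (hH : (hamiltonian h).IsHermitian) {A : ℕ → Op Λ} {τ δ : ℝ} {r : ℕ}
    (hstep : ∀ k < r, ‖evolve (hamiltonian h) (A k) τ - A (k + 1)‖ ≤ δ) :
    ‖evolve (hamiltonian h) (A 0) (r * τ) - A r‖ ≤ r * δ := by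
  induction r with
  | zero => simp
  | succ r ih =>
    have h1 := ih fun k hk => hstep k (by omega)
    have h2 := hstep r (Nat.lt_succ_self r)
    have e : evolve (hamiltonian h) (A 0) ((r + 1 : ℕ) * τ) - A (r + 1) =
        evolve (hamiltonian h) (evolve (hamiltonian h) (A 0) (r * τ) - A r) τ +
          (evolve (hamiltonian h) (A r) τ - A (r + 1)) := by
      rw [evolve_sub, ← evolve_add, sub_add_sub_cancel]
      push_cast
      rw [add_mul, one_mul]
    rw [e]
    refine (norm_add_le _ _).trans ?_
    rw [norm_evolve hH]
    push_cast
    linarith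

/-- The light-cone approximation for `r` time steps. -/
theorem exists_evolve_sub_lightCone_le {d : ℕ} (hd : 1 ≤ d) {α : ℝ} (hα : (d : ℝ) + 1 < α)
    (p Γ : ℕ) (hpΓ : p + 1 ≤ Γ) :
    ∃ C : ℝ, 0 < C ∧ ∀ (Λ : Finset (Fin d → ℤ)) (h : Λ → Λ → Op Λ), IsPowerLaw α h →
      ∀ (c : EuclideanSpace ℝ (Fin d)) (x₀ : ℝ), 0 ≤ x₀ →
      ∀ A : Op Λ, SupportedOn A (ballSites Λ c x₀) →
      ∀ r ℓ : ℕ, 1 ≤ r → 1 ≤ ℓ → ∀ t : ℝ, 0 ≤ t →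
        ‖evolve (hamiltonian h) A t -
            evolve (lightConeHamiltonian h c x₀ ((r : ℝ) * (Γ : ℝ) * (ℓ : ℝ))) A t‖
          ≤ C * ‖A‖ * (t * (x₀ + (r : ℝ) * (Γ : ℝ) * (ℓ : ℝ)) ^ (d - 1) *
              (1 / (ℓ : ℝ) ^ (α - (d : ℝ) - 1) + (ℓ : ℝ) * (t ^ p / (r : ℝ) ^ p))) := by
  obtain ⟨C, hC0, hC⟩ := exists_evolve_sub_restrictBall_le hd hα p
  -- `2 * C` comes from comparing both evolutions with the same approximant, `2` from the trivial
  -- bound for `τ > 1`.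
  refine ⟨2 * C + 2, by positivity, ?_⟩
  intro Λ h hh c x₀ hx A hA r ℓ hr hℓ t ht
  have hr1 : (1 : ℝ) ≤ r := by exact_mod_cast hr
  have hr0 : (r : ℝ) ≠ 0 := by positivity
  have hℓ1 : (1 : ℝ) ≤ ℓ := by exact_mod_cast hℓ
  have hΓ1 : (p : ℝ) + 1 ≤ Γ := by exact_mod_cast hpΓ
  have hp0 : (0 : ℝ) ≤ p := Nat.cast_nonneg p
  have hrp : 1 / (ℓ : ℝ) ^ (α - (d : ℝ) - 1) = (ℓ : ℝ) ^ ((d : ℝ) + 1 - α) := by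
    rw [one_div, ← Real.rpow_neg (by positivity)]
    congr 1
    ring
  rw [hrp, lightConeHamiltonian_eq, ← div_pow]
  set R := x₀ + (r : ℝ) * (Γ : ℝ) * (ℓ : ℝ) with hR
  set P := (ℓ : ℝ) ^ ((d : ℝ) + 1 - α) with hP
  have hP0 : 0 ≤ P := by positivity
  have hR1 : 1 ≤ R := by
    have : (1 : ℝ) ≤ r * Γ * ℓ :=
      one_le_mul_of_one_le_of_one_le (one_le_mul_of_one_le_of_one_le hr1 (by linarith)) hℓ1
    linarith
  have hgp := hh.restrictBall c R
  set τ := t / r with hτ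
  have hτ0 : 0 ≤ τ := by positivity
  have htτ : (r : ℝ) * τ = t := mul_div_cancel₀ t hr0
  rcases le_or_gt τ 1 with hτ1 | hτ1
  · set y : ℕ → ℝ := fun k => x₀ + k * (Γ * ℓ) with hy
    have hyR : ∀ k, k ≤ r → y k ≤ R := fun k hk => by
      have : (k : ℝ) ≤ r := by exact_mod_cast hk
      rw [hR, mul_assoc]
      simp only [hy]
      gcongr
    -- The common approximant: step `k + 1` evolves with the restriction of `h` to the ball of
    -- radius `y (k + 1)`.
    set S : ℕ → Op Λ := fun k => Nat.rec A
      (fun k B => evolve (hamiltonian (restrictBall h c (y (k + 1)))) B τ) k with hS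
    have hS1 : ∀ k, S (k + 1) = evolve (hamiltonian (restrictBall h c (y (k + 1)))) (S k) τ :=
      fun k => rfl
    have hSc : ∀ k, CommutesOutside c (y k) (S k) ∧ ‖S k‖ = ‖A‖ := by
      intro k
      induction k with
      | zero =>
        refine ⟨?_, rfl⟩
        have : y 0 = x₀ := by simp [hy]
        rw [this]
        exact hA.commutesOutside
      | succ k ih =>
        rw [hS1, norm_evolve (hh.restrictBall _ _).hamiltonian_isHermitian]
        refine ⟨ih.1.evolve_restrictBall hh ?_ τ, ih.2⟩
        simp only [hy]
        gcongr
        omega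
    set δ := C * ‖A‖ * (τ * R ^ (d - 1) * (P + ℓ * τ ^ p)) with hδ
    -- Stated for any `h'` with the same restrictions as `h`, to be used for `h` itself and for its
    -- restriction to the light cone.
    have hstep : ∀ h' : Λ → Λ → Op Λ, IsPowerLaw α h' →
        (∀ k < r, restrictBall h' c (y (k + 1)) = restrictBall h c (y (k + 1))) →
        ∀ k < r, ‖evolve (hamiltonian h') (S k) τ - S (k + 1)‖ ≤ δ := by
      intro h' hh' hre k hk
      rw [hS1, ← hre k hk]
      have hyk : 0 ≤ y k := by positivity
      have hyk' : 0 ≤ y (k + 1) := by positivity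
      refine (hC Λ h' hh' c (y k) (y (k + 1)) ℓ hyk hℓ1 ?_ (S k) (hSc k).1 τ hτ0 hτ1).trans ?_
      · have : ((p : ℝ) + 1) * ℓ ≤ Γ * ℓ := by gcongr
        simp only [hy]
        push_cast
        linarith
      · rw [(hSc k).2, hδ]
        have := hyR (k + 1) hk
        gcongr
    have h1 := norm_evolve_sub_step_le hh.hamiltonian_isHermitian (hstep h hh fun _ _ => rfl)
    have h2 := norm_evolve_sub_step_le hgp.hamiltonian_isHermitian
      (hstep _ hgp fun k hk => restrictBall_restrictBall h c (hyR (k + 1) hk))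
    rw [htτ] at h1 h2
    have hS0 : S 0 = A := rfl
    rw [hS0] at h1 h2
    calc _ ≤ ‖evolve (hamiltonian h) A t - S r‖ +
          ‖S r - evolve (hamiltonian (restrictBall h c R)) A t‖ :=
            norm_sub_le_norm_sub_add_norm_sub _ _ _
      _ ≤ r * δ + r * δ := add_le_add h1 (by rwa [norm_sub_rev])
      _ = 2 * C * ‖A‖ * ((r * τ) * R ^ (d - 1) * (P + ℓ * τ ^ p)) := by rw [hδ]; ring
      _ = 2 * C * ‖A‖ * (t * R ^ (d - 1) * (P + ℓ * τ ^ p)) := by rw [htτ]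
      _ ≤ (2 * C + 2) * ‖A‖ * (t * R ^ (d - 1) * (P + ℓ * τ ^ p)) := by
        gcongr
        linarith
  · have ht1 : 1 ≤ t := by
      rw [← htτ]
      exact one_le_mul_of_one_le_of_one_le hr1 hτ1.le
    -- For `τ > 1` every factor of the claimed bound is at least `1`, in particular `ℓ * τ ^ p`.
    have hbig : 1 ≤ t * R ^ (d - 1) * (P + ℓ * τ ^ p) := by
      refine one_le_mul_of_one_le_of_one_le
        (one_le_mul_of_one_le_of_one_le ht1 (one_le_pow₀ hR1)) ?_
      have := one_le_mul_of_one_le_of_one_le hℓ1 (one_le_pow₀ (n := p) hτ1.le)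
      linarith
    calc _ ≤ ‖evolve (hamiltonian h) A t‖ +
          ‖evolve (hamiltonian (restrictBall h c R)) A t‖ := norm_sub_le _ _
      _ = 2 * ‖A‖ * 1 := by
        rw [norm_evolve hh.hamiltonian_isHermitian, norm_evolve hgp.hamiltonian_isHermitian]
        ring
      _ ≤ (2 * C + 2) * ‖A‖ * (t * R ^ (d - 1) * (P + ℓ * τ ^ p)) := by
        gcongr
        linarith

end LocalObs

theorem proposition4p1 (d : ℕ) (hd : 1 ≤ d) (α : ℝ) (hα : 2 * (d : ℝ) < α)
    (p Υ Γ : ℕ) (hp : 1 ≤ p) (hΓ : Γ = Υ + 1) :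
    ∃ C : ℝ, 0 < C ∧
      ∀ a : ℕ → ℕ → ℝ, LocalObs.IsProductFormula p Υ Γ a →
      ∀ (Λ : Finset (Fin d → ℤ)) (h : Λ → Λ → LocalObs.Op Λ), LocalObs.IsPowerLaw α h →
      ∀ (c : EuclideanSpace ℝ (Fin d)) (x₀ : ℝ), 0 ≤ x₀ →
      ∀ A : LocalObs.Op Λ, LocalObs.SupportedOn A (LocalObs.ballSites Λ c x₀) →
      ∀ r ℓ : ℕ, 1 ≤ r → 1 ≤ ℓ → ∀ t : ℝ, 0 ≤ t →
        LocalObs.SupportedOn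
          (LocalObs.lightConeHamiltonian h c x₀ ((r : ℝ) * (Γ : ℝ) * (ℓ : ℝ)))
          (LocalObs.ballSites Λ c (x₀ + (r : ℝ) * (Γ : ℝ) * (ℓ : ℝ))) ∧
        ‖LocalObs.evolve (LocalObs.hamiltonian h) A t -
            LocalObs.evolve
              (LocalObs.lightConeHamiltonian h c x₀ ((r : ℝ) * (Γ : ℝ) * (ℓ : ℝ))) A t‖
          ≤ C * ‖A‖ * (t * (x₀ + (r : ℝ) * (Γ : ℝ) * (ℓ : ℝ)) ^ (d - 1) *
              (1 / (ℓ : ℝ) ^ (α - (d : ℝ) - 1) + (ℓ : ℝ) * (t ^ p / (r : ℝ) ^ p))) := by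
  have hd1 : (1 : ℝ) ≤ d := by exact_mod_cast hd
  subst hΓ
  -- The constant must be chosen before `a`, hence the case distinction. For `p > Υ` no product
  -- formula exists and any constant serves.
  by_cases hpΥ : p ≤ Υ
  -- Here `d + 1 ≤ 2 * d < α`, as `d ≥ 1`.
  · obtain ⟨C, hC0, hC⟩ := LocalObs.exists_evolve_sub_lightCone_le hd
      (show (d : ℝ) + 1 < α by linarith) p (Υ + 1) (by omega)
    refine ⟨C, hC0, fun a _ Λ h hh c x₀ hx A hA r ℓ hr hℓ t ht =>
      ⟨?_, hC Λ h hh c x₀ hx A hA r ℓ hr hℓ t ht⟩⟩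
    rw [LocalObs.lightConeHamiltonian_eq]
    exact hh.supportedOn_restrictBall c _
  · exact ⟨1, one_pos, fun a ha => absurd ha.order_le hpΥ⟩
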